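/- For a Laurent polynomial $a$ over $\mathbb C$ put $a^*(z)=\overline{a(\overline z^{\,-1})}$. Let $\mathcal S$ be the set of pairs $(a,b)$ of Laurent polynomials with $aa^*+bb^*=1$ and $0<a^*(0)<\infty$, and for $\eta\in(0,1)$ let $\mathcal S_\eta$ be the set of $(a,b)\in\mathcal S$ such that $b$ is a polynomial and $0<\sup_{|z|=1}|b(z)|\le 1-\eta$. The inverse nonlinear Fourier transform of $(a,b)$ is the finitely supported sequence $\boldsymbol\gamma=(\gamma_k)_{k\in\mathbb Z}$ of complex numbers with $$\begin{pmatrix} a(z)&b(z)\\-b^*(z)&a^*(z)\end{pmatrix}=\prod_{k}\frac1{\sqrt{1+|\gamma_k|^2}}\begin{pmatrix}1&\gamma_kz^k\\-\overline{\gamma_k}z^{-k}&1\end{pmatrix}$$ (product in increasing order of $k$). For $(a_0,b_0)\in\mathcal S_\eta$ with $\deg b_0<n$, the layer stripping algorithm acts on the coefficient vectors of length $n$ of $a_0^*$ and $b_0$ by $$\gamma_k=\frac{b_k(0)}{a_k^*(0)},\qquad a_{k+1}^*(z)=\frac{a_k^*(z)+\overline{\gamma_k}\,b_k(z)}{\sqrt{1+|\gamma_k|^2}},\qquad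 b_{k+1}(z)=\frac{b_k(z)-\gamma_ka_k^*(z)}{z\sqrt{1+|\gamma_k|^2}},$$ where the coefficient vectors are shortened by one entry in each step; it returns $(\gamma_0,\dots,\gamma_{n-1})$. Run in floating-point arithmetic with machine precision $\epsilon_{\mathrm{ma}}>0$, it starts from the exact coefficients, and each basic operation (the four arithmetic operations and the square root) with exact value $x$ returns $x(1+\delta)$ for some $|\delta|\le\epsilon_{\mathrm{ma}}$ ($\delta$ is real for operations on real numbers and complex for operations on complex numbers; negation and conjugation are exact). Let $\hat{\boldsymbol\gamma}\in\mathbb C^n$ be any output of such a run. Norms are Euclidean. **Theorem.** There are absolute constants $c,C,C'>0$ such that the following holds for all $\eta\in(0,1)$, all $n\in\mathbb N$, all $(a_0,b_0)\in\mathcal S_\eta$ with $\deg b_0<n$ and $a_0^*$ outer (that is, $a_0^*$ has no zeros in the open unit disk), with inverse nonlinear Fourier transform $\boldsymbol\gamma$. 1. If $\epsilon_{\mathrm{ma}}>0$ and $n^3\eta^{-5/2}\epsilon_{\mathrm{ma}}\le c$, then $\boldsymbol\gamma\neq0$ is supported in $\{0,\dots,n-1\}$, and every output $\hat{\boldsymbol\gamma}$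 of the layer stripping algorithm run in floating-point arithmetic with machine precision $\epsilon_{\mathrm{ma}}$ satisfies $$\frac{\|\hat{\boldsymbol\gamma}-\boldsymbol\gamma\|}{\|\boldsymbol\gamma\|}\le C\,n^3\eta^{-5/2}\epsilon_{\mathrm{ma}} .$$ 2. Hence $O(\log(n\eta^{-1}\epsilon^{-1}))$ bits of precision suffice for the target precision $\epsilon\in(0,1)$: if $r\in\mathbb N$ and $r\ge C'\log(n\eta^{-1}\epsilon^{-1})$, then every output $\hat{\boldsymbol\gamma}$ of a run with machine precision $\epsilon_{\mathrm{ma}}=2^{-r}$ satisfies $\|\hat{\boldsymbol\gamma}-\boldsymbol\gamma\|/\|\boldsymbol\gamma\|\le\epsilon$. -/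

import Mathlib

open scoped Polynomial LaurentPolynomial

namespace NLFT

/-! ## Laurent polynomials and the nonlinear Fourier transform over SU(2) -/

/-- The conjugate `a^*(z) = conj (a (1 / conj z))` of a complex Laurent polynomial: conjugate all
coefficients and substitute `z⁻¹` for `z`. -/
noncomputable def conjStar (a : ℂ[T;T⁻¹]) : ℂ[T;T⁻¹] :=
  LaurentPolynomial.invert (AddMonoidAlgebra.mapRingHom ℤ (starRingEnd ℂ) a)

theorem conjStar_coeff (a : ℂ[T;T⁻¹]) (k : ℤ) :
    (conjStar a).coeff k = starRingEnd ℂ (a.coeff (-k)) := by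
  simp [conjStar]

/-- The factor `(1 + |g|²)^(-1/2) * [1, g z^k; -conj g z^(-k), 1]` of the transform. -/
noncomputable def nlftFactor (g : ℂ) (k : ℤ) : Matrix (Fin 2) (Fin 2) ℂ[T;T⁻¹] :=
  LaurentPolynomial.C (((√(1 + ‖g‖ ^ 2))⁻¹ : ℝ) : ℂ) •
    !![1, LaurentPolynomial.C g * LaurentPolynomial.T k;
       -(LaurentPolynomial.C (starRingEnd ℂ g) * LaurentPolynomial.T (-k)), 1]

/-- The nonlinear Fourier transform of a finitely supported sequence `γ : ℤ → ℂ`: the product of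
its factors in increasing order of the index `k`. The factors outside of the support are the
identity matrix and are left out. -/
noncomputable def nlft (γ : ℤ →₀ ℂ) : Matrix (Fin 2) (Fin 2) ℂ[T;T⁻¹] :=
  ((γ.support.sort (· ≤ ·)).map fun k => nlftFactor (γ k) k).prod

/-- `γ` is the inverse nonlinear Fourier transform of `(a, b)`. -/
def IsInverseNLFT (γ : ℤ →₀ ℂ) (a b : ℂ[T;T⁻¹]) : Prop :=
  nlft γ = !![a, b; -conjStar b, conjStar a]

/-- The set `𝒮` of pairs of Laurent polynomials with `a a^* + b b^* = 1` and `0 < a^*(0) < ∞`.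
That the value of `a^*` at `0` is finite means that `a^*` is a polynomial. -/
def setS : Set (ℂ[T;T⁻¹] × ℂ[T;T⁻¹]) :=
  {ab | ab.1 * conjStar ab.1 + ab.2 * conjStar ab.2 = 1 ∧
    ∃ p : ℂ[X], Polynomial.toLaurent p = conjStar ab.1 ∧
      (p.eval 0).im = 0 ∧ 0 < (p.eval 0).re}

/-- The set `𝒮_η` of those `(a, b) ∈ 𝒮` for which `b` is a polynomial with
`0 < sup_{|z| = 1} |b(z)| ≤ 1 - η`. -/
def setSEta (η : ℝ) : Set (ℂ[T;T⁻¹] × ℂ[T;T⁻¹]) :=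
  {ab | ab ∈ setS ∧ ∃ q : ℂ[X], Polynomial.toLaurent q = ab.2 ∧
    0 < (⨆ z : Circle, ‖q.eval (z : ℂ)‖) ∧ (⨆ z : Circle, ‖q.eval (z : ℂ)‖) ≤ 1 - η}

/-- An outer polynomial: a polynomial without zeros in the open unit disk. -/
def IsOuter (f : ℂ[T;T⁻¹]) : Prop :=
  ∃ p : ℂ[X], Polynomial.toLaurent p = f ∧ ∀ z : ℂ, ‖z‖ < 1 → p.eval z ≠ 0

/-! ## Floating-point arithmetic and the layer stripping algorithm -/

/-- The standard model of floating-point arithmetic with machine precision `ε`: `y` is an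
admissible computed value of a basic operation whose exact value is `x`. It is used for operations
on real numbers (with a real `δ`) and on complex numbers (with a complex `δ`). -/
def Rounded {𝕜 : Type*} [NormedField 𝕜] (ε : ℝ) (x y : 𝕜) : Prop :=
  ∃ δ : 𝕜, ‖δ‖ ≤ ε ∧ y = x * (1 + δ)

/-- `r` is computed as `√(1 + ((Re g)² + (Im g)²))` in floating-point arithmetic. -/
def ComputedRadius (ε : ℝ) (g : ℂ) (r : ℝ) : Prop :=
  ∃ x y s t : ℝ, Rounded ε (g.re * g.re) x ∧ Rounded ε (g.im * g.im) y ∧ Rounded ε (x + y) s ∧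
    Rounded ε (1 + s) t ∧ Rounded ε (√t) r

/-- `ComputedEntry ε r w u v y`: the value `(u + w v) / r` is computed as `y` in floating-point
arithmetic, in one of the usual orders of evaluation of an entry of a Givens rotation. -/
inductive ComputedEntry (ε r : ℝ) (w u v : ℂ) : ℂ → Prop
  /-- evaluation as `(u + w * v) / r` -/
  | divide {p s y : ℂ} : Rounded ε (w * v) p → Rounded ε (u + p) s → Rounded ε (s / (r : ℂ)) y →
      ComputedEntry ε r w u v y
  /-- evaluation as `(1 / r) * (u + w * v)` -/
  | scale {c : ℝ} {p s y : ℂ} : Rounded ε (1 / r) c → Rounded ε (w * v) p →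
      Rounded ε (u + p) s → Rounded ε ((c : ℂ) * s) y → ComputedEntry ε r w u v y
  /-- evaluation as `c * u + (c * w) * v` with `c = 1 / r` -/
  | entries {c : ℝ} {d p q y : ℂ} : Rounded ε (1 / r) c → Rounded ε ((c : ℂ) * w) d →
      Rounded ε ((c : ℂ) * u) p → Rounded ε (d * v) q → Rounded ε (p + q) y →
      ComputedEntry ε r w u v y

/-- A run in floating-point arithmetic of the layer stripping algorithm on the coefficient vectors
`a₀, b₀` of length `n`. In exact arithmetic it computes, for `k < n`, `g k = b_k(0) / a_k^*(0)`,
and, for `k + 1 < n`,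
`a_{k+1}^*(z) = (a_k^*(z) + conj (g k) b_k(z)) / √(1 + |g k|²)` and
`b_{k+1}(z) = (b_k(z) - g k * a_k^*(z)) / (z √(1 + |g k|²))`,
where `A k j` and `B k j`, for `j < n - k`, are the coefficients of `z^j` in `a_k^*` and `b_k`.
Negation and complex conjugation are exact. -/
structure LayerStrippingRun (ε : ℝ) (n : ℕ) (a₀ b₀ : ℕ → ℂ)
    (A B : ℕ → ℕ → ℂ) (g : ℕ → ℂ) (r : ℕ → ℝ) : Prop where
  init_a : ∀ j < n, A 0 j = a₀ j
  init_b : ∀ j < n, B 0 j = b₀ j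
  coefficient : ∀ k < n, Rounded ε (B k 0 / A k 0) (g k)
  radius : ∀ k, k + 1 < n → ComputedRadius ε (g k) (r k)
  step_a : ∀ k j, k + 1 + j < n →
    ComputedEntry ε (r k) (starRingEnd ℂ (g k)) (A k j) (B k j) (A (k + 1) j)
  step_b : ∀ k j, k + 1 + j < n →
    ComputedEntry ε (r k) (-g k) (B k (j + 1)) (A k (j + 1)) (B (k + 1) j)

/-- `g` is a possible output of the layer stripping algorithm on `(a, b)`, run on coefficient
vectors of length `n` in floating-point arithmetic with machine precision `ε`. -/
def LayerStrippingOutput (ε : ℝ) (n : ℕ) (a b : ℂ[T;T⁻¹]) (g : EuclideanSpace ℂ (Fin n)) : Prop :=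
  ∃ (A B : ℕ → ℕ → ℂ) (g' : ℕ → ℂ) (r : ℕ → ℝ),
    LayerStrippingRun ε n (fun j => (conjStar a).coeff (j : ℤ)) (fun j => b.coeff (j : ℤ))
      A B g' r ∧ ∀ k : Fin n, g k = g' k

/-- The vector `(γ_0, …, γ_{n-1})`, with the Euclidean norm. -/
noncomputable def coeffVec (n : ℕ) (γ : ℤ →₀ ℂ) : EuclideanSpace ℂ (Fin n) :=
  WithLp.toLp 2 fun k => γ (k : ℤ)

/-- Relative error of `g` as an approximation of `x` (meant for `x ≠ 0`). -/
noncomputable def relError {n : ℕ} (g x : EuclideanSpace ℂ (Fin n)) : ℝ :=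
  ‖g - x‖ / ‖x‖

/-- With `r` bits of precision, that is with machine precision `2⁻ʳ`, the layer stripping
algorithm on `(a, b)` always returns `x` up to relative error at most `τ`. -/
def BitsSuffice (r n : ℕ) (a b : ℂ[T;T⁻¹]) (x : EuclideanSpace ℂ (Fin n)) (τ : ℝ) : Prop :=
  ∀ g : EuclideanSpace ℂ (Fin n), LayerStrippingOutput ((2 : ℝ)⁻¹ ^ r) n a b g → relError g x ≤ τ

/-- The setting: `0 < η < 1`, `(a, b) ∈ 𝒮_η`, `a^*` is outer, the degree of `b` is less than `n`,
and `γ` is the inverse nonlinear Fourier transform of `(a, b)`. -/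
structure OuterInstance (n : ℕ) (η : ℝ) (a b : ℂ[T;T⁻¹]) (γ : ℤ →₀ ℂ) : Prop where
  eta_pos : 0 < η
  eta_lt_one : η < 1
  mem : (a, b) ∈ setSEta η
  outer : IsOuter (conjStar a)
  degree_lt : ∀ k : ℤ, (n : ℤ) ≤ k → b.coeff k = 0
  inverse : IsInverseNLFT γ a b

end NLFT

namespace NLFT

open LaurentPolynomial

/-! ## Laurent polynomials: conjugation, order and the `ℓ²` norm of the coefficients -/

/-! Write `α = a^*`. Layer stripping rotates the column `(b, α)` by unitary factors, so rounding
errors add up without being amplified. If the dropped coefficients are carried along exactly, a run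
with computed coefficients `g` is the exact rotation by `g` plus a residual `(R₁, R₂)` of norm `O(n
ε)`, and the sum has the vanishing orders of a stripped column
(`LayerStrippingRun.exists_residual`). It remains to bound `g k - γ k` by the residual.

This is where outerness enters. On the circle `|α|² = 1 - |b|² ≥ η`, and `α` has no zeros in the
closed disk, so some polynomial `t` satisfies `α t = 1 + O(z^n)`, and multiplication by `t` has norm
at most `L = 2 / √η` on `ℓ²` (`exists_approx_inverse`). Multiplied by `t`, the vanishing orders
become a linear system for the entries `A`, `B` of the partial product: `A (t b) - B = O(z^(k+1))`
and `B^* (t b) + A^* = κ + O(z)`, up to `t R₁` and `t R₂`. Its coupling through `t b` is skew: in `A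
· (second) - B^* · (first)` the terms with `t b` cancel and the squared norms remain. Hence the
system is coercive with a constant independent of `t b`, and two solutions, suitably scaled, differ
by `O(‖t R₁‖ + ‖t R₂‖)` in the first entry. Since the coefficient `k` of `B` is `γ k` times the
constant coefficient `c` of `A`, this bounds `c² |g k - γ k|` (`norm_sub_le_of_stripped`). As `c ≥ 1
/ L`, the total loss is `L⁴ = 16 / η²`, which is better than `η^(-5/2)`.

For a relative bound, `R₁` must also be small with the data. It is at most of order `n ε (‖b‖ + ∑ |g
j|)`, and `‖b‖ ≤ ∑ |γ j|`. Summing over `k` absorbs `∑ |g j|` into `∑ |γ j|`; the sum over `k` and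
the passage from `ℓ¹` to `ℓ²` contribute the other two factors `n`. -/

theorem conjStar_add (f g : ℂ[T;T⁻¹]) : conjStar (f + g) = conjStar f + conjStar g := by
  simp [conjStar]

theorem conjStar_sub (f g : ℂ[T;T⁻¹]) : conjStar (f - g) = conjStar f - conjStar g := by
  simp [conjStar]

theorem conjStar_mul (f g : ℂ[T;T⁻¹]) : conjStar (f * g) = conjStar f * conjStar g := by
  simp [conjStar]

@[simp]
theorem conjStar_one : conjStar 1 = 1 := by
  simp [conjStar]

@[simp]
theorem conjStar_zero : conjStar 0 = 0 := by
  simp [conjStar]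

@[simp]
theorem conjStar_conjStar (f : ℂ[T;T⁻¹]) : conjStar (conjStar f) = f := by
  ext k
  simp [conjStar_coeff]

@[simp]
theorem conjStar_C (c : ℂ) : conjStar (C c) = C (starRingEnd ℂ c) := by
  ext k
  rw [conjStar_coeff, C_apply, C_apply]
  by_cases h : k = 0 <;> simp [h]

@[simp]
theorem conjStar_T (k : ℤ) : conjStar (T k) = T (-k) := by
  ext j
  rw [conjStar_coeff, T_apply, T_apply]
  by_cases h : k = -j
  · simp [h]
  · have h' : ¬ -k = j := fun h' => h (by omega)
    simp [h, h']

theorem coeff_T_mul (f : ℂ[T;T⁻¹]) (m k : ℤ) : (T m * f).coeff k = f.coeff (k - m) := by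
  have h := AddMonoidAlgebra.coeff_single_mul_eq_mul_coeff (x := f) (r := (1 : ℂ)) (m := m)
    (m₁ := k) (k - m) (fun m' _ => by constructor <;> intro h <;> omega)
  rwa [one_mul] at h

theorem coeff_C_mul (c : ℂ) (f : ℂ[T;T⁻¹]) (k : ℤ) : (C c * f).coeff k = c * f.coeff k := by
  rw [← smul_eq_C_mul]; simp

/-- All coefficients of `f` of index less than `m` vanish. -/
def OrderGE (m : ℤ) (f : ℂ[T;T⁻¹]) : Prop := ∀ k < m, f.coeff k = 0

namespace OrderGE

variable {m m' : ℤ} {f g : ℂ[T;T⁻¹]}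

theorem mono (hf : OrderGE m f) (h : m' ≤ m) : OrderGE m' f := fun k hk => hf k (by omega)

theorem add (hf : OrderGE m f) (hg : OrderGE m g) : OrderGE m (f + g) := fun k hk => by
  simp [hf k hk, hg k hk]

theorem sub (hf : OrderGE m f) (hg : OrderGE m g) : OrderGE m (f - g) := fun k hk => by
  simp [hf k hk, hg k hk]

theorem mul (hf : OrderGE m f) (hg : OrderGE m' g) : OrderGE (m + m') (f * g) := fun k hk => by
  rw [AddMonoidAlgebra.coeff_mul]
  refine Finset.sum_eq_zero fun i hi => Finset.sum_eq_zero fun j hj => ?_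
  refine if_neg ?_
  rintro rfl
  by_cases h : i < m
  · exact (Finsupp.mem_support_iff.1 hi) (hf i h)
  · exact (Finsupp.mem_support_iff.1 hj) (hg j (by omega))

theorem coeff_mul (hf : OrderGE m f) (hg : OrderGE m' g) :
    (f * g).coeff (m + m') = f.coeff m * g.coeff m' := by
  rw [AddMonoidAlgebra.coeff_mul]
  have key : ∀ i ∈ f.coeff.support, ∀ j ∈ g.coeff.support,
      (if i + j = m + m' then f.coeff i * g.coeff j else 0)
        = if i = m then (if j = m' then f.coeff i * g.coeff j else 0) else 0 := by
    intro i hi j hj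
    have h1 : m ≤ i := not_lt.1 fun h => Finsupp.mem_support_iff.1 hi (hf i h)
    have h2 : m' ≤ j := not_lt.1 fun h => Finsupp.mem_support_iff.1 hj (hg j h)
    split_ifs <;> first | rfl | omega
  refine (Finset.sum_congr rfl fun i hi => Finset.sum_congr rfl fun j hj => key i hi j hj).trans ?_
  simp only [Finset.sum_ite_irrel, Finset.sum_const_zero, Finset.sum_ite_eq']
  by_cases h1 : f.coeff m = 0 <;> by_cases h2 : g.coeff m' = 0 <;> simp [h1, h2]

theorem C (c : ℂ) : OrderGE 0 (C c) := fun k hk => by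
  rw [C_apply, if_neg (by omega)]

theorem one : OrderGE 0 (1 : ℂ[T;T⁻¹]) := by
  simpa using OrderGE.C 1

theorem T (k : ℤ) : OrderGE k (T k : ℂ[T;T⁻¹]) := fun j hj => by
  rw [T_apply, if_neg (by omega)]

theorem C_mul (c : ℂ) (hf : OrderGE m f) : OrderGE m (LaurentPolynomial.C c * f) := fun k hk => by
  rw [coeff_C_mul, hf k hk, mul_zero]

theorem T_mul (k : ℤ) (hf : OrderGE m f) : OrderGE (k + m) (LaurentPolynomial.T k * f) :=
  (OrderGE.T k).mul hf

end OrderGE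

/-! ### The Hilbert space of coefficient sequences -/

theorem memℓp_coeff (f : ℂ[T;T⁻¹]) : Memℓp (fun k : ℤ => f.coeff k) 2 := by
  refine (memℓp_zero ?_).of_exponent_ge zero_le
  exact f.coeff.hasFiniteSupport.subset fun k hk => by simpa using hk

/-- The coefficient sequence of a Laurent polynomial, as an element of `ℓ²(ℤ)`. -/
noncomputable def toL2 : ℂ[T;T⁻¹] →ₗ[ℂ] lp (fun _ : ℤ => ℂ) 2 where
  toFun f := ⟨fun k => f.coeff k, memℓp_coeff f⟩
  map_add' _ _ := rfl
  map_smul' _ _ := rfl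

theorem toL2_apply (f : ℂ[T;T⁻¹]) (k : ℤ) : toL2 f k = f.coeff k := rfl

/-- Turns norm estimates into algebraic identities read off at index zero. Both sides are additive
in `g`, so monomials suffice. -/
theorem inner_toL2 (f g : ℂ[T;T⁻¹]) :
    inner ℂ (toL2 f) (toL2 g) = (conjStar f * g).coeff 0 := by
  induction g using LaurentPolynomial.induction_on' with
  | add p q hp hq => rw [map_add, inner_add_right, hp, hq, mul_add]; simp
  | C_mul_T n a =>
    have h : toL2 (C a * T n) = lp.single 2 n a := by
      ext k
      rw [toL2_apply, lp.coeFn_single, coeff_C_mul, T_apply, Pi.single_apply]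
      by_cases h : n = k
      · simp [h]
      · simp [h, Ne.symm h]
    rw [h, lp.inner_single_right, toL2_apply, mul_left_comm, coeff_C_mul, mul_comm (conjStar f),
      coeff_T_mul, conjStar_coeff]
    simp

theorem norm_toL2_sq (f : ℂ[T;T⁻¹]) : ((‖toL2 f‖ ^ 2 : ℝ) : ℂ) = (conjStar f * f).coeff 0 := by
  rw [← inner_toL2, inner_self_eq_norm_sq_to_K]; simp

theorem norm_coeff_zero_mul_le (f g : ℂ[T;T⁻¹]) :
    ‖(conjStar f * g).coeff 0‖ ≤ ‖toL2 f‖ * ‖toL2 g‖ := by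
  rw [← inner_toL2]; exact norm_inner_le_norm _ _

theorem norm_toL2_conjStar (f : ℂ[T;T⁻¹]) : ‖toL2 (conjStar f)‖ = ‖toL2 f‖ := by
  have h : ((‖toL2 (conjStar f)‖ ^ 2 : ℝ) : ℂ) = ((‖toL2 f‖ ^ 2 : ℝ) : ℂ) := by
    rw [norm_toL2_sq, norm_toL2_sq, conjStar_conjStar, mul_comm]
  exact (pow_left_inj₀ (norm_nonneg _) (norm_nonneg _) two_ne_zero).1 (by exact_mod_cast h)

/-- Cauchy–Schwarz: a coefficient of a product is the inner product with a reflected, conjugated and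
shifted copy of one factor. -/
theorem norm_coeff_mul_le (f g : ℂ[T;T⁻¹]) (k : ℤ) :
    ‖(f * g).coeff k‖ ≤ ‖toL2 f‖ * ‖toL2 g‖ := by
  have h1 : (f * g).coeff k = (conjStar (T k * conjStar f) * g).coeff 0 := by
    rw [conjStar_mul, conjStar_conjStar, conjStar_T, mul_assoc, coeff_T_mul]; simp
  have h2 : ‖toL2 (T k * conjStar f)‖ = ‖toL2 f‖ := by
    have h : ((‖toL2 (T k * conjStar f)‖ ^ 2 : ℝ) : ℂ) = ((‖toL2 f‖ ^ 2 : ℝ) : ℂ) := by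
      rw [norm_toL2_sq, norm_toL2_sq, conjStar_mul, conjStar_T, conjStar_conjStar,
        mul_mul_mul_comm, ← T_add, neg_add_cancel, T_zero, one_mul, mul_comm]
    exact (pow_left_inj₀ (norm_nonneg _) (norm_nonneg _) two_ne_zero).1 (by exact_mod_cast h)
  rw [h1, ← h2]
  exact norm_coeff_zero_mul_le _ _

theorem norm_toL2_T_mul (k : ℤ) (f : ℂ[T;T⁻¹]) : ‖toL2 (T k * f)‖ = ‖toL2 f‖ := by
  have h : ((‖toL2 (T k * f)‖ ^ 2 : ℝ) : ℂ) = ((‖toL2 f‖ ^ 2 : ℝ) : ℂ) := by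
    rw [norm_toL2_sq, norm_toL2_sq, conjStar_mul, conjStar_T,
      mul_mul_mul_comm, ← T_add, neg_add_cancel, T_zero, one_mul]
  exact (pow_left_inj₀ (norm_nonneg _) (norm_nonneg _) two_ne_zero).1 (by exact_mod_cast h)

theorem norm_toL2_C_mul (c : ℂ) (f : ℂ[T;T⁻¹]) : ‖toL2 (C c * f)‖ = ‖c‖ * ‖toL2 f‖ := by
  rw [← smul_eq_C_mul, map_smul, norm_smul]

theorem norm_coeff_le (f : ℂ[T;T⁻¹]) (k : ℤ) : ‖f.coeff k‖ ≤ ‖toL2 f‖ :=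
  lp.norm_apply_le_norm two_ne_zero (toL2 f) k

theorem norm_toL2_one : ‖toL2 1‖ = 1 := by
  have h := norm_toL2_sq 1
  rw [conjStar_one, one_mul, ← map_one C, C_apply, if_pos rfl] at h
  exact (pow_eq_one_iff_of_nonneg (norm_nonneg _) two_ne_zero).1 (by exact_mod_cast h)

theorem norm_toL2_sq_eq_sum (f : ℂ[T;T⁻¹]) (s : Finset ℤ) (hs : ∀ k ∉ s, f.coeff k = 0) :
    ‖toL2 f‖ ^ 2 = ∑ k ∈ s, ‖f.coeff k‖ ^ 2 := by
  have h := lp.norm_rpow_eq_tsum (p := 2) (by norm_num) (toL2 f)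
  norm_num at h
  rw [h, tsum_eq_sum (s := s)]
  · rfl
  · intro k hk
    simp [toL2_apply, hs k hk]

/-! ## Parseval's identity and multiplication operators -/

theorem norm_toL2_toLaurent_sq (p : ℂ[X]) :
    ‖toL2 (Polynomial.toLaurent p)‖ ^ 2 =
      Real.circleAverage (fun θ ↦ ‖p.eval θ‖ ^ 2) 0 1 := by
  rw [← p.sum_sq_norm_coeff_eq_circleAverage,
    norm_toL2_sq_eq_sum _ (p.support.map Nat.castEmbedding)]
  · rw [Finset.sum_map]
    refine Finset.sum_congr rfl fun i _ => ?_
    rw [coeff_toLaurent, Finsupp.mapDomain_apply Nat.castEmbedding.injective]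
    rfl
  · intro k hk
    rw [← support_coeff_toLaurent] at hk
    exact Finsupp.notMem_support_iff.1 hk

theorem orderGE_toLaurent (p : ℂ[X]) : OrderGE 0 (Polynomial.toLaurent p) := fun k hk => by
  by_contra h
  have h' : k ∈ (Polynomial.toLaurent p).coeff.support := Finsupp.mem_support_iff.2 h
  rw [support_coeff_toLaurent, Finset.mem_map] at h'
  obtain ⟨j, -, rfl⟩ := h'
  simp at hk
  omega

/-- A shift, which is isometric, makes `f` a polynomial; Parseval then reduces the bound to a
pointwise one on the circle. -/
theorem norm_toL2_mul_le_of_norm_eval_le {q : ℂ[X]} {M : ℝ}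
    (hq : ∀ z : Circle, ‖q.eval (z : ℂ)‖ ≤ M) (f : ℂ[T;T⁻¹]) :
    ‖toL2 (Polynomial.toLaurent q * f)‖ ≤ M * ‖toL2 f‖ := by
  have hM : 0 ≤ M := (norm_nonneg _).trans (hq 1)
  obtain ⟨m, p, hp⟩ := exists_T_pow f
  have h1 : ‖toL2 f‖ = ‖toL2 (Polynomial.toLaurent p)‖ := by
    rw [hp, mul_comm, norm_toL2_T_mul]
  have h2 : ‖toL2 (Polynomial.toLaurent q * f)‖ = ‖toL2 (Polynomial.toLaurent (q * p))‖ := by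
    rw [map_mul Polynomial.toLaurent, hp, ← mul_assoc, mul_comm _ (T _), norm_toL2_T_mul]
  rw [h1, h2]
  refine le_of_sq_le_sq ?_ (by positivity)
  rw [mul_pow, norm_toL2_toLaurent_sq, norm_toL2_toLaurent_sq,
    ← smul_eq_mul (M ^ 2), ← Real.circleAverage_fun_smul]
  apply Real.circleAverage_mono
  · exact Continuous.continuousOn (by fun_prop) |>.circleIntegrable'
  · exact Continuous.continuousOn (by fun_prop) |>.circleIntegrable'
  · intro z hz
    have hz' : ‖z‖ = 1 := by simpa using hz
    have := hq ⟨z, by simpa [Submonoid.unitSphere] using hz'⟩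
    simp only [Polynomial.eval_mul, norm_mul, mul_pow, smul_eq_mul]
    gcongr

/-! ## Approximate inverses of outer polynomials -/

/-- A truncated geometric series inverts `X - ρ` up to `1 - (X / ρ)^N`. As `|ρ| > 1`, a large `N`
makes this `1` to order `n` and a multiplier of norm close to `1`. Allowing every `M > 1` makes the
induction work. -/
theorem exists_approx_inverse_of_roots (s : Multiset ℂ) (hs : ∀ ρ ∈ s, 1 < ‖ρ‖) (n : ℕ) :
    ∀ M : ℝ, 1 < M → ∃ t q : ℂ[X], (s.map fun ρ => Polynomial.X - Polynomial.C ρ).prod * t = q ∧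
      OrderGE n (Polynomial.toLaurent q - 1) ∧
      ∀ f, ‖toL2 (Polynomial.toLaurent q * f)‖ ≤ M * ‖toL2 f‖ := by
  induction s using Multiset.induction_on with
  | empty =>
    intro M hM
    refine ⟨1, 1, by simp, fun k _ => by simp, fun f => ?_⟩
    rw [map_one, one_mul]
    nlinarith [norm_nonneg (toL2 f)]
  | cons ρ s ih =>
    intro M hM
    have hρ : 1 < ‖ρ‖ := hs ρ (Multiset.mem_cons_self _ _)
    have hρ0 : ρ ≠ 0 := norm_pos_iff.1 (by linarith)
    -- The budget `M` is split as `√M · √M` between the new root and the remaining ones.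
    have hM' : 1 < √M := by rw [Real.lt_sqrt (by norm_num)]; simpa using hM
    obtain ⟨t, q, hq, hord, hbd⟩ := ih (fun σ hσ => hs σ (Multiset.mem_cons_of_mem hσ)) _ hM'
    have htend : Filter.Tendsto (fun N : ℕ => ‖ρ⁻¹‖ ^ N) Filter.atTop (nhds 0) := by
      refine tendsto_pow_atTop_nhds_zero_of_lt_one (norm_nonneg _) ?_
      rw [norm_inv]; exact inv_lt_one_of_one_lt₀ hρ
    obtain ⟨N, hN1, hN2⟩ := ((htend.eventually_lt_const (sub_pos.2 hM')).and
      (Filter.eventually_ge_atTop n)).exists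
    set y : ℂ[X] := Polynomial.C ρ⁻¹ * Polynomial.X with hy
    have hXρ : Polynomial.X - Polynomial.C ρ = Polynomial.C ρ * (y - 1) := by
      rw [hy, mul_sub, ← mul_assoc, ← Polynomial.C_mul, mul_inv_cancel₀ hρ0]; simp
    have hone : (Polynomial.X - Polynomial.C ρ) *
        (-Polynomial.C ρ⁻¹ * ∑ j ∈ Finset.range N, y ^ j) = 1 - y ^ N := by
      have h1 : Polynomial.C ρ * Polynomial.C ρ⁻¹ = 1 := by
        rw [← Polynomial.C_mul, mul_inv_cancel₀ hρ0]; simp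
      have h2 := geom_sum_mul y N
      rw [hXρ]
      linear_combination (-(y - 1) * ∑ j ∈ Finset.range N, y ^ j) * h1 - h2
    have hyN : Polynomial.toLaurent (1 - y ^ N) = 1 - C (ρ⁻¹ ^ N) * T N := by
      rw [hy, mul_pow, ← Polynomial.C_pow]; simp
    refine ⟨(-Polynomial.C ρ⁻¹ * ∑ j ∈ Finset.range N, y ^ j) * t, (1 - y ^ N) * q, ?_, ?_, ?_⟩
    · rw [Multiset.map_cons, Multiset.prod_cons, mul_mul_mul_comm, hq, hone]
    · rw [map_mul, hyN]
      have h : (1 - C (ρ⁻¹ ^ N) * T N) * Polynomial.toLaurent q - 1 =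
          (Polynomial.toLaurent q - 1) - C (ρ⁻¹ ^ N) * (T N * Polynomial.toLaurent q) := by ring
      rw [h]
      refine hord.sub (OrderGE.C_mul _ ?_)
      exact ((orderGE_toLaurent q).T_mul N).mono (by omega)
    · intro f
      rw [map_mul Polynomial.toLaurent, hyN]
      have h : (1 - C (ρ⁻¹ ^ N) * T N) * Polynomial.toLaurent q * f =
          Polynomial.toLaurent q * f - C (ρ⁻¹ ^ N) * (T N * (Polynomial.toLaurent q * f)) := by ring
      rw [h, map_sub]
      refine (norm_sub_le _ _).trans ?_
      rw [norm_toL2_C_mul, norm_toL2_T_mul, norm_pow]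
      have h1 := hbd f
      have h2 : √M * √M = M := Real.mul_self_sqrt (by linarith)
      calc ‖toL2 (Polynomial.toLaurent q * f)‖ + ‖ρ⁻¹‖ ^ N * ‖toL2 (Polynomial.toLaurent q * f)‖
          = (1 + ‖ρ⁻¹‖ ^ N) * ‖toL2 (Polynomial.toLaurent q * f)‖ := by ring
        _ ≤ √M * (√M * ‖toL2 f‖) := by gcongr; linarith
        _ = M * ‖toL2 f‖ := by rw [← mul_assoc, h2]

theorem eval₂_conjStar (z : Circle) (f : ℂ[T;T⁻¹]) :
    eval₂ (RingHom.id ℂ) (Circle.toUnits z) (conjStar f) =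
      starRingEnd ℂ (eval₂ (RingHom.id ℂ) (Circle.toUnits z) f) := by
  induction f using LaurentPolynomial.induction_on' with
  | add p q hp hq => rw [conjStar_add, map_add, hp, hq, map_add, map_add]
  | C_mul_T n a =>
    rw [conjStar_mul, conjStar_C, conjStar_T, eval₂_C_mul_T, eval₂_C_mul_T, map_mul]
    have h : ((Circle.toUnits z ^ n : ℂˣ) : ℂ) = ((z ^ n : Circle) : ℂ) := by simp
    have h' : ((Circle.toUnits z ^ (-n) : ℂˣ) : ℂ) = (((z ^ n)⁻¹ : Circle) : ℂ) := by simp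
    rw [h, h', Circle.coe_inv_eq_conj]
    rfl

/-- For `h = t f` the product `p h` has norm at most `2 ‖f‖` by the choice of `t`, while `‖p h‖² =
‖h‖² - ‖q h‖² ≥ (1 - (1 - η)²) ‖h‖² ≥ η ‖h‖²`. -/
theorem exists_approx_inverse {p q : ℂ[X]} {η : ℝ} (hη : 0 < η) (hη1 : η < 1)
    (hpq : Polynomial.toLaurent p * conjStar (Polynomial.toLaurent p) +
      Polynomial.toLaurent q * conjStar (Polynomial.toLaurent q) = 1)
    (hq : ∀ z : Circle, ‖q.eval (z : ℂ)‖ ≤ 1 - η)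
    (hp : ∀ z : ℂ, ‖z‖ < 1 → p.eval z ≠ 0) (n : ℕ) :
    ∃ t : ℂ[X], OrderGE n (Polynomial.toLaurent p * Polynomial.toLaurent t - 1) ∧
      ∀ f, √η * ‖toL2 (Polynomial.toLaurent t * f)‖ ≤ 2 * ‖toL2 f‖ := by
  -- On the circle `|p|² = 1 - |q|² > 0`, so all roots lie strictly outside the closed disk.
  have hcircle : ∀ z : Circle, p.eval (z : ℂ) ≠ 0 := by
    intro z hz
    have h := congrArg (eval₂ (RingHom.id ℂ) (Circle.toUnits z)) hpq
    simp only [map_add, map_mul, eval₂_conjStar, eval₂_toLaurent, map_one] at h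
    simp only [Circle.toUnits_apply, Units.val_mk0, Polynomial.eval₂_id, hz, zero_mul,
      zero_add, Complex.mul_conj] at h
    have h1 : Complex.normSq (q.eval (z : ℂ)) = 1 := by exact_mod_cast h
    rw [Complex.normSq_eq_norm_sq] at h1
    nlinarith [hq z, norm_nonneg (q.eval (z : ℂ))]
  have hp0 : p ≠ 0 := fun h => hp 0 (by simp) (by simp [h])
  have hroots : ∀ ρ ∈ p.roots, 1 < ‖ρ‖ := by
    intro ρ hρ
    have hρ' : p.eval ρ = 0 := (Polynomial.mem_roots hp0).1 hρ
    refine lt_of_le_of_ne (not_lt.1 fun h => hp ρ h hρ') fun h => ?_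
    exact hcircle ⟨ρ, by simp [Submonoid.unitSphere, ← h]⟩ hρ'
  obtain ⟨t, r, hr, hord, hbd⟩ := exists_approx_inverse_of_roots p.roots hroots n 2 (by norm_num)
  have hfac := (IsAlgClosed.splits p).eq_prod_roots
  have hlead : p.leadingCoeff ≠ 0 := by simpa using hp0
  have hpt : p * (Polynomial.C p.leadingCoeff⁻¹ * t) = r := by
    rw [← hr]
    have h1 : Polynomial.C p.leadingCoeff * Polynomial.C p.leadingCoeff⁻¹ = 1 := by
      rw [← Polynomial.C_mul, mul_inv_cancel₀ hlead]; simp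
    linear_combination (Polynomial.C p.leadingCoeff⁻¹ * t) * hfac +
      ((p.roots.map fun ρ => Polynomial.X - Polynomial.C ρ).prod * t) * h1
  refine ⟨Polynomial.C p.leadingCoeff⁻¹ * t, by rw [← map_mul, hpt]; exact hord, fun f => ?_⟩
  obtain ⟨h, hh⟩ : ∃ h, h = Polynomial.toLaurent (Polynomial.C p.leadingCoeff⁻¹ * t) * f := ⟨_, rfl⟩
  rw [← hh]
  have h1 : ‖toL2 (Polynomial.toLaurent p * h)‖ ≤ 2 * ‖toL2 f‖ := by
    rw [hh, ← mul_assoc, ← map_mul Polynomial.toLaurent, hpt]; exact hbd f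
  have h2 : ‖toL2 (Polynomial.toLaurent q * h)‖ ≤ (1 - η) * ‖toL2 h‖ :=
    norm_toL2_mul_le_of_norm_eval_le hq h
  have h3 : ‖toL2 (Polynomial.toLaurent p * h)‖ ^ 2 + ‖toL2 (Polynomial.toLaurent q * h)‖ ^ 2 =
      ‖toL2 h‖ ^ 2 := by
    have : ((‖toL2 (Polynomial.toLaurent p * h)‖ ^ 2 : ℝ) : ℂ) +
        ((‖toL2 (Polynomial.toLaurent q * h)‖ ^ 2 : ℝ) : ℂ) = ((‖toL2 h‖ ^ 2 : ℝ) : ℂ) := by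
      rw [norm_toL2_sq, norm_toL2_sq, norm_toL2_sq, conjStar_mul (Polynomial.toLaurent p),
        conjStar_mul (Polynomial.toLaurent q),
        ← Finsupp.add_apply, ← AddMonoidAlgebra.coeff_add]
      congr 2
      linear_combination (conjStar h * h) * hpq
    exact_mod_cast this
  refine le_trans (le_of_sq_le_sq ?_ (norm_nonneg _)) h1
  rw [mul_pow, Real.sq_sqrt hη.le]
  have h4 : ‖toL2 (Polynomial.toLaurent q * h)‖ ^ 2 ≤ ((1 - η) * ‖toL2 h‖) ^ 2 := by gcongr
  nlinarith [mul_nonneg (mul_nonneg hη.le (sub_nonneg.2 hη1.le)) (sq_nonneg ‖toL2 h‖)]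

/-! ## Partial products of the nonlinear Fourier transform -/

/-- The factor `(1 + |g|²)^(-1/2)`. -/
noncomputable def invRadius (g : ℂ) : ℝ := (√(1 + ‖g‖ ^ 2))⁻¹

theorem invRadius_pos (g : ℂ) : 0 < invRadius g := by unfold invRadius; positivity

theorem invRadius_sq_mul (g : ℂ) : invRadius g ^ 2 * (1 + ‖g‖ ^ 2) = 1 := by
  have h : 0 < 1 + ‖g‖ ^ 2 := by positivity
  rw [invRadius, inv_pow, Real.sq_sqrt h.le, inv_mul_cancel₀ h.ne']

theorem invRadius_le_one (g : ℂ) : invRadius g ≤ 1 := by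
  have h := invRadius_sq_mul g
  have h' := invRadius_pos g
  nlinarith [sq_nonneg (invRadius g * ‖g‖)]

theorem C_invRadius_mul (g : ℂ) :
    C (invRadius g : ℂ) * C (invRadius g : ℂ) * (1 + C g * C (starRingEnd ℂ g)) = 1 := by
  rw [← map_mul, ← map_mul, ← map_one (C : ℂ →+* _), ← map_add, ← map_mul]
  congr 1
  have h := congrArg (fun x : ℝ => (x : ℂ)) (invRadius_sq_mul g)
  simp only [Complex.ofReal_mul, Complex.ofReal_pow, Complex.ofReal_add, Complex.ofReal_one] at h
  rw [Complex.mul_conj, Complex.normSq_eq_norm_sq]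
  push_cast
  linear_combination h

/-- For the product `[p, q; -q^*, p^*]` of the first `k` factors of the transform of `g`, the
pair `(p^*, q)`. -/
noncomputable def partialPair (g : ℕ → ℂ) : ℕ → ℂ[T;T⁻¹] × ℂ[T;T⁻¹]
  | 0 => (1, 0)
  | k + 1 =>
    (C (invRadius (g k) : ℂ) *
      ((partialPair g k).1 - C (g k) * (T k * conjStar (partialPair g k).2)),
     C (invRadius (g k) : ℂ) *
      ((partialPair g k).2 + C (g k) * (T k * conjStar (partialPair g k).1)))

/-- The constant coefficient of the first entry of `partialPair g k`. -/
noncomputable def partialScale (g : ℕ → ℂ) (k : ℕ) : ℝ := ∏ j ∈ Finset.range k, invRadius (g j)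

section PartialPair

variable (g : ℕ → ℂ)

theorem partialPair_fst_succ (k : ℕ) : (partialPair g (k + 1)).1 = C (invRadius (g k) : ℂ) *
    ((partialPair g k).1 - C (g k) * (T k * conjStar (partialPair g k).2)) := rfl

theorem partialPair_snd_succ (k : ℕ) : (partialPair g (k + 1)).2 = C (invRadius (g k) : ℂ) *
    ((partialPair g k).2 + C (g k) * (T k * conjStar (partialPair g k).1)) := rfl

theorem conjStar_partialPair_fst_succ (k : ℕ) :
    conjStar (partialPair g (k + 1)).1 = C (invRadius (g k) : ℂ) * (conjStar (partialPair g k).1 -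
      C (starRingEnd ℂ (g k)) * (T (-k) * (partialPair g k).2)) := by
  rw [partialPair_fst_succ, conjStar_mul, conjStar_sub, conjStar_mul, conjStar_mul,
    conjStar_conjStar, conjStar_C, conjStar_C, conjStar_T, Complex.conj_ofReal]

theorem conjStar_partialPair_snd_succ (k : ℕ) :
    conjStar (partialPair g (k + 1)).2 = C (invRadius (g k) : ℂ) * (conjStar (partialPair g k).2 +
      C (starRingEnd ℂ (g k)) * (T (-k) * (partialPair g k).1)) := by
  rw [partialPair_snd_succ, conjStar_mul, conjStar_add, conjStar_mul, conjStar_mul,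
    conjStar_conjStar, conjStar_C, conjStar_C, conjStar_T, Complex.conj_ofReal]

theorem T_mul_T_neg (k : ℤ) : (T k : ℂ[T;T⁻¹]) * T (-k) = 1 := by
  rw [← T_add, add_neg_cancel, T_zero]

theorem partialPair_unitary (k : ℕ) :
    (partialPair g k).1 * conjStar (partialPair g k).1 +
      (partialPair g k).2 * conjStar (partialPair g k).2 = 1 := by
  induction k with
  | zero => simp [partialPair]
  | succ k ih =>
    rw [conjStar_partialPair_fst_succ, conjStar_partialPair_snd_succ, partialPair_fst_succ,
      partialPair_snd_succ]
    have h1 := C_invRadius_mul (g k)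
    have h2 := T_mul_T_neg (k : ℤ)
    generalize (partialPair g k).1 = X at *
    generalize (partialPair g k).2 = Y at *
    generalize conjStar X = X' at *
    generalize conjStar Y = Y' at *
    generalize C (invRadius (g k) : ℂ) = r at *
    generalize (T (k : ℤ) : ℂ[T;T⁻¹]) = t at *
    generalize (T (-(k : ℤ)) : ℂ[T;T⁻¹]) = t' at *
    generalize C (g k) = γ at *
    generalize C (starRingEnd ℂ (g k)) = γ' at *
    linear_combination h1 + (r * r * (1 + γ * γ')) * ih +
      (r * r * γ * γ' * (X * X' + Y * Y')) * h2

/-- The orders of the conjugates are degree bounds in disguise: `k` for the first entry and `k - 1`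
for the second. -/
theorem orderGE_partialPair (k : ℕ) :
    OrderGE 0 (partialPair g k).1 ∧ OrderGE 0 (partialPair g k).2 ∧
      OrderGE (-k) (conjStar (partialPair g k).1) ∧
      OrderGE (1 - k) (conjStar (partialPair g k).2) := by
  induction k with
  | zero =>
    refine ⟨OrderGE.one, fun _ _ => rfl, ?_, ?_⟩
    · simpa [partialPair] using OrderGE.one
    · intro _ _
      simp [partialPair]
  | succ k ih =>
    obtain ⟨h1, h2, h3, h4⟩ := ih
    rw [conjStar_partialPair_fst_succ, conjStar_partialPair_snd_succ]
    refine ⟨(h1.sub (OrderGE.C_mul _ ((h4.T_mul k).mono ?_))).C_mul _,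
      (h2.add (OrderGE.C_mul _ ((h3.T_mul k).mono ?_))).C_mul _,
      ((h3.mono ?_).sub (OrderGE.C_mul _ ((h2.T_mul (-k)).mono ?_))).C_mul _,
      ((h4.mono ?_).add (OrderGE.C_mul _ ((h1.T_mul (-k)).mono ?_))).C_mul _⟩ <;> push_cast <;> omega

/-- One better than the general bound. The gain leaves order `1`, not `0`, after multiplication by
something of order `k + 1`. -/
theorem orderGE_conjStar_partialPair_fst_succ (k : ℕ) :
    OrderGE (-k) (conjStar (partialPair g (k + 1)).1) := by
  obtain ⟨-, h2, h3, -⟩ := orderGE_partialPair g k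
  rw [conjStar_partialPair_fst_succ]
  exact (h3.sub (OrderGE.C_mul _ ((h2.T_mul (-k)).mono (by omega)))).C_mul _

theorem orderGE_conjStar_partialPair_snd_succ (k : ℕ) :
    OrderGE (-k) (conjStar (partialPair g (k + 1)).2) :=
  (orderGE_partialPair g (k + 1)).2.2.2.mono (by push_cast; omega)

theorem partialPair_fst_coeff_zero (k : ℕ) :
    (partialPair g k).1.coeff 0 = (partialScale g k : ℂ) := by
  induction k with
  | zero => simp [partialPair, partialScale]
  | succ k ih =>
    have h := ((orderGE_partialPair g k).2.2.2.T_mul k) 0 (by omega)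
    rw [partialPair_fst_succ, coeff_C_mul, AddMonoidAlgebra.coeff_sub, Finsupp.sub_apply,
      coeff_C_mul, h, ih, partialScale, partialScale, Finset.prod_range_succ]
    push_cast
    ring

/-- With `partialPair_fst_coeff_zero` this recovers `g k` as a quotient of two coefficients of the
partial product. -/
theorem partialPair_snd_coeff (k : ℕ) :
    (partialPair g (k + 1)).2.coeff k = g k * (partialScale g (k + 1) : ℂ) := by
  have h : (partialPair g k).2.coeff k = 0 := by
    have h' := (orderGE_partialPair g k).2.2.2 (-k) (by omega)
    rw [conjStar_coeff] at h'
    simpa using h'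
  rw [partialPair_snd_succ, coeff_C_mul, AddMonoidAlgebra.coeff_add, Finsupp.add_apply,
    coeff_C_mul, coeff_T_mul, h, sub_self, conjStar_coeff, neg_zero, partialPair_fst_coeff_zero,
    partialScale, partialScale, Finset.prod_range_succ, Complex.conj_ofReal]
  push_cast
  ring

theorem partialScale_pos (k : ℕ) : 0 < partialScale g k :=
  Finset.prod_pos fun _ _ => invRadius_pos _

theorem partialScale_antitone : Antitone (partialScale g) := by
  refine antitone_nat_of_succ_le fun k => ?_
  rw [partialScale, partialScale, Finset.prod_range_succ]
  exact mul_le_of_le_one_right (partialScale_pos g k).le (invRadius_le_one _)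

theorem partialScale_le_one (k : ℕ) : partialScale g k ≤ 1 := by
  simpa [partialScale] using partialScale_antitone g (Nat.zero_le k)

theorem norm_partialPair_sq (k : ℕ) :
    ‖toL2 (partialPair g k).1‖ ^ 2 + ‖toL2 (partialPair g k).2‖ ^ 2 = 1 := by
  have h := congrArg (fun f : ℂ[T;T⁻¹] => f.coeff 0) (partialPair_unitary g k)
  simp only [AddMonoidAlgebra.coeff_add, Finsupp.add_apply] at h
  rw [mul_comm, ← norm_toL2_sq, mul_comm, ← norm_toL2_sq, ← map_one C, C_apply, if_pos rfl] at h
  exact_mod_cast h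

theorem norm_partialPair_fst_le (k : ℕ) : ‖toL2 (partialPair g k).1‖ ≤ 1 := by
  have h := norm_partialPair_sq g k
  rw [← sq_le_one_iff₀ (norm_nonneg _)]
  nlinarith [sq_nonneg ‖toL2 (partialPair g k).2‖]

theorem norm_partialPair_snd_le (k : ℕ) : ‖toL2 (partialPair g k).2‖ ≤ 1 := by
  have h := norm_partialPair_sq g k
  rw [← sq_le_one_iff₀ (norm_nonneg _)]
  nlinarith [sq_nonneg ‖toL2 (partialPair g k).1‖]

/-- Each factor adds at most `‖g j‖`. Applied to `b`, this is what makes the final error relative to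
`γ`. -/
theorem norm_partialPair_snd_le_sum (k : ℕ) :
    ‖toL2 (partialPair g k).2‖ ≤ ∑ j ∈ Finset.range k, ‖g j‖ := by
  induction k with
  | zero => simp [partialPair]
  | succ k ih =>
    rw [partialPair_snd_succ, norm_toL2_C_mul, map_add, Finset.sum_range_succ]
    have h1 := norm_add_le (toL2 (partialPair g k).2)
      (toL2 (C (g k) * (T k * conjStar (partialPair g k).1)))
    rw [norm_toL2_C_mul, norm_toL2_T_mul, norm_toL2_conjStar] at h1
    have h2 := norm_partialPair_fst_le g k
    have h3 : ‖((invRadius (g k) : ℝ) : ℂ)‖ ≤ 1 := by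
      rw [Complex.norm_real, Real.norm_of_nonneg (invRadius_pos _).le]
      exact invRadius_le_one _
    nlinarith [norm_nonneg (g k), norm_nonneg (toL2 ((partialPair g k).2 +
      C (g k) * (T k * conjStar (partialPair g k).1))), mul_le_of_le_one_right (norm_nonneg (g k)) h2,
      mul_le_of_le_one_left (norm_nonneg (toL2 (partialPair g k).2 +
        toL2 (C (g k) * (T k * conjStar (partialPair g k).1)))) h3]

/-- The two entries of the column that is left of `(b, α)` when the first `k` factors of the
transform of `g` are split off. -/
noncomputable def stripped (α b : ℂ[T;T⁻¹]) (k : ℕ) : ℂ[T;T⁻¹] × ℂ[T;T⁻¹] :=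
  ((partialPair g k).1 * b - (partialPair g k).2 * α,
    conjStar (partialPair g k).2 * b + conjStar (partialPair g k).1 * α)

theorem stripped_fst_succ (α b : ℂ[T;T⁻¹]) (k : ℕ) :
    (stripped g α b (k + 1)).1 = C (invRadius (g k) : ℂ) *
      ((stripped g α b k).1 - C (g k) * (T k * (stripped g α b k).2)) := by
  simp only [stripped]
  rw [partialPair_fst_succ, partialPair_snd_succ]
  ring

theorem stripped_snd_succ (α b : ℂ[T;T⁻¹]) (k : ℕ) :
    (stripped g α b (k + 1)).2 = C (invRadius (g k) : ℂ) *
      ((stripped g α b k).2 + C (starRingEnd ℂ (g k)) * (T (-k) * (stripped g α b k).1)) := by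
  simp only [stripped]
  rw [conjStar_partialPair_fst_succ, conjStar_partialPair_snd_succ]
  ring

end PartialPair

/-! ## Perturbation of the partial products -/

section Perturbation

variable {α b t : ℂ[T;T⁻¹]}

/-- Multiplication by `t` replaces `α` by `1` up to order `k + 1`. In the second relation this error
meets `A^*`, which starts at index `-k`, so order `1` is left and only the constant `κ` is
undetermined; unitarity then fixes `κ`. -/
theorem residual_relations (g : ℕ → ℂ) {R₁ R₂ : ℂ[T;T⁻¹]} {k : ℕ} (ht : OrderGE 0 t)
    (hinv : OrderGE (k + 1) (α * t - 1))
    (h1 : OrderGE (k + 1) ((stripped g α b (k + 1)).1 + R₁))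
    (h2 : OrderGE 0 ((stripped g α b (k + 1)).2 + R₂)) :
    OrderGE (k + 1) ((partialPair g (k + 1)).1 * (t * b) - (partialPair g (k + 1)).2 + t * R₁) ∧
    ∃ κ : ℂ, OrderGE 1 (conjStar (partialPair g (k + 1)).2 * (t * b) +
        conjStar (partialPair g (k + 1)).1 + t * R₂ - C κ) ∧
      ‖(partialScale g (k + 1) : ℂ) * κ - 1‖ ≤ ‖toL2 (t * R₁)‖ + ‖toL2 (t * R₂)‖ := by
  obtain ⟨hA, hB, -, -⟩ := orderGE_partialPair g (k + 1)
  have hA' := orderGE_conjStar_partialPair_fst_succ g k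
  have hB' := orderGE_conjStar_partialPair_snd_succ g k
  have hA0 := partialPair_fst_coeff_zero g (k + 1)
  have hun := partialPair_unitary g (k + 1)
  have hAn := norm_partialPair_fst_le g (k + 1)
  have hBn := norm_partialPair_snd_le g (k + 1)
  simp only [stripped] at h1 h2
  generalize (partialPair g (k + 1)).1 = A at *
  generalize (partialPair g (k + 1)).2 = B at *
  have e1 : OrderGE (k + 1) (A * (t * b) - B + t * R₁) := by
    have h : A * (t * b) - B + t * R₁ = t * (A * b - B * α + R₁) + B * (α * t - 1) := by ring
    rw [h]
    exact ((ht.mul h1).mono (by omega)).add ((hB.mul hinv).mono (by omega))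
  have e2 : OrderGE 0 (conjStar B * (t * b) + conjStar A + t * R₂ + conjStar A * (α * t - 1)) := by
    have h : conjStar B * (t * b) + conjStar A + t * R₂ + conjStar A * (α * t - 1) =
        t * (conjStar B * b + conjStar A * α + R₂) := by ring
    rw [h]
    exact (ht.mul h2).mono (by omega)
  have e3 : OrderGE 1 (conjStar A * (α * t - 1)) := (hA'.mul hinv).mono (by omega)
  have e4 : OrderGE 0 (conjStar B * (t * b) + conjStar A + t * R₂) := by
    simpa using e2.sub (e3.mono (by omega))
  set κ : ℂ := (conjStar B * (t * b) + conjStar A + t * R₂).coeff 0 with hκ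
  have e5 : OrderGE 1 (conjStar B * (t * b) + conjStar A + t * R₂ - C κ) := by
    intro j hj
    rw [AddMonoidAlgebra.coeff_sub, Finsupp.sub_apply, C_apply]
    split_ifs with h
    · subst h
      rw [hκ, sub_self]
    · rw [e4 j (by omega), sub_zero]
  refine ⟨e1, κ, e5, ?_⟩
  have f1 := (hA.mul e5) 0 (by omega)
  have f2 := (hB'.mul e1) 0 (by omega)
  -- The terms with `t b` cancel and unitarity produces the `1`; the constant coefficient of the
  -- left side vanishes by the orders.
  have f3 : A * (conjStar B * (t * b) + conjStar A + t * R₂ - C κ) -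
      conjStar B * (A * (t * b) - B + t * R₁) =
      1 - C κ * A + A * (t * R₂) - conjStar B * (t * R₁) := by
    linear_combination hun
  have f4 : (1 - C κ * A + A * (t * R₂) - conjStar B * (t * R₁)).coeff 0 = 0 := by
    rw [← f3, AddMonoidAlgebra.coeff_sub, Finsupp.sub_apply, f1, f2, sub_zero]
  have f5 : (1 : ℂ[T;T⁻¹]).coeff 0 = 1 := by simp
  simp only [AddMonoidAlgebra.coeff_sub, AddMonoidAlgebra.coeff_add, Finsupp.sub_apply,
    Finsupp.add_apply, coeff_C_mul, hA0, f5] at f4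
  have f6 : (partialScale g (k + 1) : ℂ) * κ - 1 =
      (A * (t * R₂)).coeff 0 - (conjStar B * (t * R₁)).coeff 0 := by
    linear_combination -f4
  rw [f6]
  have f7 := norm_coeff_mul_le A (t * R₂) 0
  have f8 := norm_coeff_zero_mul_le B (t * R₁)
  have f9 := norm_sub_le ((A * (t * R₂)).coeff 0) ((conjStar B * (t * R₁)).coeff 0)
  nlinarith [norm_nonneg (toL2 (t * R₁)), norm_nonneg (toL2 (t * R₂))]

/-- Both sequences solve the same linear system, `h` with a residual. The energy identity for the
difference of the scaled solutions bounds it with a constant that does not depend on `t b`. -/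
theorem norm_sub_le_of_stripped (g h : ℕ → ℂ) {R₁ R₂ : ℂ[T;T⁻¹]} {k : ℕ} (ht : OrderGE 0 t)
    (hinv : OrderGE (k + 1) (α * t - 1))
    (hg1 : OrderGE (k + 1) (stripped g α b (k + 1)).1)
    (hg2 : OrderGE 0 (stripped g α b (k + 1)).2)
    (hh1 : OrderGE (k + 1) ((stripped h α b (k + 1)).1 + R₁))
    (hh2 : OrderGE 0 ((stripped h α b (k + 1)).2 + R₂)) :
    partialScale g (k + 1) ^ 2 * ‖h k - g k‖ ≤
      3 * (‖toL2 (t * R₁)‖ + ‖toL2 (t * R₂)‖) * (‖toL2 (t * b)‖ + ‖h k‖) + ‖toL2 (t * R₁)‖ := by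
  obtain ⟨a1, κ, a2, a3⟩ := residual_relations g (R₁ := 0) (R₂ := 0) ht hinv
    (by simpa using hg1) (by simpa using hg2)
  obtain ⟨c1, μ, c2, c3⟩ := residual_relations h ht hinv hh1 hh2
  have hA := (orderGE_partialPair g (k + 1)).1
  have hP := (orderGE_partialPair h (k + 1)).1
  have hB := orderGE_conjStar_partialPair_snd_succ g k
  have hQ := orderGE_conjStar_partialPair_snd_succ h k
  have hA0 := partialPair_fst_coeff_zero g (k + 1)
  have hP0 := partialPair_fst_coeff_zero h (k + 1)
  have hBk := partialPair_snd_coeff g k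
  have hQk := partialPair_snd_coeff h k
  have hd1 := partialScale_le_one h (k + 1)
  have hd0 := partialScale_pos h (k + 1)
  generalize (partialPair g (k + 1)).1 = A at *
  generalize (partialPair g (k + 1)).2 = B at *
  generalize (partialPair h (k + 1)).1 = P at *
  generalize (partialPair h (k + 1)).2 = Q at *
  generalize partialScale g (k + 1) = c at *
  generalize partialScale h (k + 1) = d at *
  simp only [mul_zero, map_zero, norm_zero, add_zero] at a1 a2 a3
  have hκ : (c : ℂ) * κ = 1 := by
    rw [← sub_eq_zero, ← norm_eq_zero]; exact le_antisymm a3 (norm_nonneg _)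
  set E := ‖toL2 (t * R₁)‖ + ‖toL2 (t * R₂)‖ with hE
  -- Scaling by the constant coefficients turns the right side of the exact system into `1` and that
  -- of the perturbed one into `1 + δ` with `|δ| ≤ E`.
  obtain ⟨x, hx⟩ : ∃ x, x = C (d : ℂ) * P - C (c : ℂ) * A := ⟨_, rfl⟩
  obtain ⟨y, hy⟩ : ∃ y, y = C (d : ℂ) * Q - C (c : ℂ) * B := ⟨_, rfl⟩
  have hx' : conjStar x = C (d : ℂ) * conjStar P - C (c : ℂ) * conjStar A := by
    rw [hx, conjStar_sub, conjStar_mul, conjStar_mul, conjStar_C, conjStar_C, Complex.conj_ofReal,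
      Complex.conj_ofReal]
  have hy' : conjStar y = C (d : ℂ) * conjStar Q - C (c : ℂ) * conjStar B := by
    rw [hy, conjStar_sub, conjStar_mul, conjStar_mul, conjStar_C, conjStar_C, Complex.conj_ofReal,
      Complex.conj_ofReal]
  set δ : ℂ := d * μ - 1 with hδ
  have hxo : OrderGE 0 x := by rw [hx]; exact (hP.C_mul _).sub (hA.C_mul _)
  have hyo : OrderGE (-k) (conjStar y) := by rw [hy']; exact (hQ.C_mul _).sub (hB.C_mul _)
  have r1 : OrderGE (k + 1) (x * (t * b) - y + C (d : ℂ) * (t * R₁)) := by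
    have h : x * (t * b) - y + C (d : ℂ) * (t * R₁) =
        C (d : ℂ) * (P * (t * b) - Q + t * R₁) - C (c : ℂ) * (A * (t * b) - B) := by
      rw [hx, hy]; ring
    rw [h]
    exact (c1.C_mul _).sub (a1.C_mul _)
  have r2 : OrderGE 1 (conjStar y * (t * b) + conjStar x + C (d : ℂ) * (t * R₂) - C δ) := by
    have h : conjStar y * (t * b) + conjStar x + C (d : ℂ) * (t * R₂) - C δ =
        C (d : ℂ) * (conjStar Q * (t * b) + conjStar P + t * R₂ - C μ) -
          C (c : ℂ) * (conjStar B * (t * b) + conjStar A - C κ) := by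
      have h1 : C (c : ℂ) * C κ = 1 := by rw [← map_mul, hκ, map_one]
      have h2 : C δ = C (d : ℂ) * C μ - 1 := by rw [hδ, map_sub, map_mul, map_one]
      rw [hx', hy', h2]
      linear_combination -h1
    rw [h]
    exact (c2.C_mul _).sub (a2.C_mul _)
  have s1 := (hyo.mul r1) 0 (by omega)
  have s2 := (hxo.mul r2) 0 (by omega)
  -- The skew coupling cancels `t b`; at index zero the left side vanishes and the right side
  -- contains the squared norms of `x` and `y`.
  have s3 : x * (conjStar y * (t * b) + conjStar x + C (d : ℂ) * (t * R₂) - C δ) -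
      conjStar y * (x * (t * b) - y + C (d : ℂ) * (t * R₁)) =
      conjStar x * x + conjStar y * y - (C δ * x + C (d : ℂ) * (conjStar y * (t * R₁)) -
        C (d : ℂ) * (x * (t * R₂))) := by ring
  have s4 : ((‖toL2 x‖ ^ 2 + ‖toL2 y‖ ^ 2 : ℝ) : ℂ) = δ * x.coeff 0 +
      d * (conjStar y * (t * R₁)).coeff 0 - d * (x * (t * R₂)).coeff 0 := by
    have h := congrArg (fun f : ℂ[T;T⁻¹] => f.coeff 0) s3
    simp only [AddMonoidAlgebra.coeff_sub _ (conjStar y * (x * (t * b) - y + C (d : ℂ) * (t * R₁))),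
      Finsupp.sub_apply, s1, s2] at h
    simp only [AddMonoidAlgebra.coeff_sub, AddMonoidAlgebra.coeff_add, Finsupp.sub_apply,
      Finsupp.add_apply, coeff_C_mul, ← norm_toL2_sq] at h
    push_cast at h ⊢
    linear_combination -h
  have hdn : ‖(d : ℂ)‖ ≤ 1 := by rwa [Complex.norm_real, Real.norm_of_nonneg hd0.le]
  have s5 : ‖toL2 x‖ ^ 2 + ‖toL2 y‖ ^ 2 ≤
      E * ‖toL2 x‖ + ‖toL2 y‖ * ‖toL2 (t * R₁)‖ + ‖toL2 x‖ * ‖toL2 (t * R₂)‖ := by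
    have h0 : ‖toL2 x‖ ^ 2 + ‖toL2 y‖ ^ 2 = ‖((‖toL2 x‖ ^ 2 + ‖toL2 y‖ ^ 2 : ℝ) : ℂ)‖ := by
      rw [Complex.norm_real, Real.norm_of_nonneg (by positivity)]
    rw [h0, s4]
    refine (norm_sub_le _ _).trans (add_le_add ((norm_add_le _ _).trans (add_le_add ?_ ?_)) ?_)
    · rw [norm_mul]
      exact mul_le_mul c3 (norm_coeff_le _ _) (norm_nonneg _) (by positivity)
    · rw [norm_mul]
      exact (mul_le_of_le_one_left (norm_nonneg _) hdn).trans (norm_coeff_zero_mul_le _ _)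
    · rw [norm_mul]
      exact (mul_le_of_le_one_left (norm_nonneg _) hdn).trans (norm_coeff_mul_le _ _ _)
  have n1 := norm_nonneg (toL2 (t * R₁))
  have n2 := norm_nonneg (toL2 (t * R₂))
  have n3 := norm_nonneg (toL2 x)
  have n4 := norm_nonneg (toL2 y)
  have hx3 : ‖toL2 x‖ ≤ 3 * E := by
    have hE1 : ‖toL2 (t * R₁)‖ ≤ E := by linarith
    have hE2 : ‖toL2 (t * R₂)‖ ≤ E := by linarith
    have hE0 : 0 ≤ E := by linarith
    have s6 : ‖toL2 x‖ ^ 2 + ‖toL2 y‖ ^ 2 ≤ 2 * E * ‖toL2 x‖ + ‖toL2 y‖ * E := by nlinarith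
    by_contra hlt
    push Not at hlt
    -- Completing the square in `‖toL2 y‖` leaves `‖toL2 x‖ ≤ (1 + √5 / 2) E`.
    nlinarith [sq_nonneg (‖toL2 y‖ - E / 2)]
  have hyk : ‖y.coeff k‖ ≤ 3 * E * ‖toL2 (t * b)‖ + ‖toL2 (t * R₁)‖ := by
    have h := r1 k (by omega)
    simp only [AddMonoidAlgebra.coeff_sub, AddMonoidAlgebra.coeff_add, Finsupp.sub_apply,
      Finsupp.add_apply, coeff_C_mul] at h
    have h' : y.coeff k = (x * (t * b)).coeff k + d * (t * R₁).coeff k := by linear_combination -h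
    rw [h']
    refine (norm_add_le _ _).trans (add_le_add ?_ ?_)
    · exact (norm_coeff_mul_le _ _ _).trans (by gcongr)
    · rw [norm_mul]
      exact (mul_le_of_le_one_left (norm_nonneg _) hdn).trans (norm_coeff_le _ _)
  have hx0 : x.coeff 0 = (d : ℂ) ^ 2 - (c : ℂ) ^ 2 := by
    rw [hx, AddMonoidAlgebra.coeff_sub, Finsupp.sub_apply, coeff_C_mul, coeff_C_mul, hA0, hP0]; ring
  have hyk' : y.coeff k = h k * (d : ℂ) ^ 2 - g k * (c : ℂ) ^ 2 := by
    rw [hy, AddMonoidAlgebra.coeff_sub, Finsupp.sub_apply, coeff_C_mul, coeff_C_mul, hBk, hQk]; ring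
  -- Subtracting `h k` times the constant coefficient of `x` eliminates the unknown `d²`.
  have key : ((c ^ 2 : ℝ) : ℂ) * (h k - g k) = y.coeff k - h k * x.coeff 0 := by
    rw [hx0, hyk']; push_cast; ring
  have key2 : c ^ 2 * ‖h k - g k‖ = ‖y.coeff k - h k * x.coeff 0‖ := by
    rw [← key, norm_mul, Complex.norm_real, Real.norm_of_nonneg (sq_nonneg c)]
  rw [key2]
  refine (norm_sub_le _ _).trans ?_
  rw [norm_mul]
  have := mul_le_mul_of_nonneg_left ((norm_coeff_le x 0).trans hx3) (norm_nonneg (h k))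
  linarith

end Perturbation

/-! ## Rounding errors of the basic operations -/

/-- As long as the accumulated deviation is at most `1 / 10`, a further rounding costs at most `11 /
10 · ε`. -/
theorem norm_mul_one_add_sub_one_le {x δ : ℂ} {a ε : ℝ} (hε1 : ε ≤ 1 / 100) (ha : a ≤ 10)
    (hx : ‖x - 1‖ ≤ a * ε) (hδ : ‖δ‖ ≤ ε) : ‖x * (1 + δ) - 1‖ ≤ (a + 11 / 10) * ε := by
  have h : x * (1 + δ) - 1 = (x - 1) + δ + (x - 1) * δ := by ring
  have h0 : 0 ≤ ε := (norm_nonneg _).trans hδ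
  have h1 : ‖x - 1‖ * ‖δ‖ ≤ (1 / 10) * ε :=
    mul_le_mul (hx.trans (by nlinarith)) hδ (norm_nonneg _) (by norm_num)
  calc ‖x * (1 + δ) - 1‖ ≤ ‖x - 1‖ + ‖δ‖ + ‖x - 1‖ * ‖δ‖ := by
        rw [h, ← norm_mul]; exact (norm_add_le _ _).trans (add_le_add_left (norm_add_le _ _) _)
    _ ≤ (a + 11 / 10) * ε := by linarith

theorem Rounded.bounds {ε x y : ℝ} (hx : 0 ≤ x) (h : Rounded ε x y) :
    (1 - ε) * x ≤ y ∧ y ≤ (1 + ε) * x := by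
  obtain ⟨δ, hδ, rfl⟩ := h
  rw [Real.norm_eq_abs, abs_le] at hδ
  constructor <;> nlinarith

/-- Up to the square root the relative factor lies between `(1 ± ε)³`; it is relaxed to fourth
powers so that the root is `(1 ± ε)²`, and the last rounding gives `(1 ± ε)³`. -/
theorem ComputedRadius.exists_eq {ε : ℝ} {g : ℂ} {r : ℝ} (hε : 0 ≤ ε) (hε1 : ε ≤ 1 / 100)
    (h : ComputedRadius ε g r) : ∃ z : ℝ, |z - 1| ≤ 4 * ε ∧ 1 / r = invRadius g * z := by
  obtain ⟨x, y, s, t, hx, hy, hs, ht, hr⟩ := h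
  obtain ⟨x1, x2⟩ := hx.bounds (mul_self_nonneg _)
  obtain ⟨y1, y2⟩ := hy.bounds (mul_self_nonneg _)
  have hg : g.re * g.re + g.im * g.im = ‖g‖ ^ 2 := by
    rw [← Complex.normSq_eq_norm_sq, Complex.normSq_apply]
  have he : 0 ≤ 1 - ε := by linarith
  have hg0 : 0 ≤ ‖g‖ ^ 2 := sq_nonneg _
  have u1 : (1 - ε) * ‖g‖ ^ 2 ≤ x + y := by rw [← hg]; linarith
  have u2 : x + y ≤ (1 + ε) * ‖g‖ ^ 2 := by rw [← hg]; linarith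
  obtain ⟨s1, s2⟩ := hs.bounds ((mul_nonneg he hg0).trans u1)
  have s3 : (1 - ε) ^ 2 * ‖g‖ ^ 2 ≤ s := by nlinarith
  have s4 : s ≤ (1 + ε) ^ 2 * ‖g‖ ^ 2 := by nlinarith
  have v1 : (1 - ε) ^ 2 * (1 + ‖g‖ ^ 2) ≤ 1 + s := by nlinarith
  have v2 : 1 + s ≤ (1 + ε) ^ 2 * (1 + ‖g‖ ^ 2) := by nlinarith
  obtain ⟨t1, t2⟩ := ht.bounds ((by positivity : 0 ≤ (1 - ε) ^ 2 * (1 + ‖g‖ ^ 2)).trans v1)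
  set D := √(1 + ‖g‖ ^ 2) with hD
  have hD0 : 0 < D := by positivity
  have hDsq : D ^ 2 = 1 + ‖g‖ ^ 2 := Real.sq_sqrt (by positivity)
  have t3 : ((1 - ε) ^ 2 * D) ^ 2 ≤ t := by
    rw [mul_pow, hDsq]
    refine le_trans ?_ ((mul_le_mul_of_nonneg_left v1 he).trans t1)
    have : (1 - ε) ^ 4 ≤ (1 - ε) ^ 3 := pow_le_pow_of_le_one he (by linarith) (by norm_num)
    nlinarith
  have t4 : t ≤ ((1 + ε) ^ 2 * D) ^ 2 := by
    rw [mul_pow, hDsq]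
    refine (t2.trans (mul_le_mul_of_nonneg_left v2 (by linarith))).trans ?_
    have : (1 + ε) ^ 3 ≤ (1 + ε) ^ 4 := pow_le_pow_right₀ (by linarith) (by norm_num)
    nlinarith
  have q1 : (1 - ε) ^ 2 * D ≤ √t := Real.le_sqrt_of_sq_le t3
  have q2 : √t ≤ (1 + ε) ^ 2 * D := Real.sqrt_le_iff.2 ⟨by positivity, t4⟩
  obtain ⟨r1, r2⟩ := hr.bounds (Real.sqrt_nonneg _)
  have r3 : (1 - ε) ^ 3 * D ≤ r := by
    calc (1 - ε) ^ 3 * D = (1 - ε) * ((1 - ε) ^ 2 * D) := by ring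
      _ ≤ (1 - ε) * √t := mul_le_mul_of_nonneg_left q1 he
      _ ≤ r := r1
  have r4 : r ≤ (1 + ε) ^ 3 * D := by
    calc r ≤ (1 + ε) * √t := r2
      _ ≤ (1 + ε) * ((1 + ε) ^ 2 * D) := mul_le_mul_of_nonneg_left q2 (by linarith)
      _ = (1 + ε) ^ 3 * D := by ring
  have he3 : 0 < (1 - ε) ^ 3 := pow_pos (by linarith) 3
  have hr0 : 0 < r := lt_of_lt_of_le (mul_pos he3 hD0) r3
  refine ⟨D / r, ?_, by rw [invRadius, ← hD]; field_simp⟩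
  rw [abs_le, neg_le_sub_iff_le_add, sub_le_iff_le_add, div_le_iff₀ hr0, ← sub_le_iff_le_add,
    le_div_iff₀ hr0]
  constructor
  · have h1 : (1 - 4 * ε) * (1 + ε) ^ 3 ≤ 1 := by
      have h : (1 - 4 * ε) * (1 + ε) ^ 3 = 1 - (ε + 9 * ε ^ 2 + 11 * ε ^ 3 + 4 * ε ^ 4) := by ring
      rw [h, sub_le_self_iff]
      positivity
    calc (1 - 4 * ε) * r ≤ (1 - 4 * ε) * ((1 + ε) ^ 3 * D) :=
          mul_le_mul_of_nonneg_left r4 (by linarith)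
      _ = (1 - 4 * ε) * (1 + ε) ^ 3 * D := by ring
      _ ≤ D := mul_le_of_le_one_left hD0.le h1
  · have h1 : 1 ≤ (4 * ε + 1) * (1 - ε) ^ 3 := by
      have h : (4 * ε + 1) * (1 - ε) ^ 3 = 1 + (ε * (1 - 9 * ε) + ε ^ 3 * (11 - 4 * ε)) := by ring
      rw [h, le_add_iff_nonneg_right]
      exact add_nonneg (mul_nonneg hε (by linarith))
        (mul_nonneg (pow_nonneg hε 3) (by linarith))
    calc D ≤ (4 * ε + 1) * (1 - ε) ^ 3 * D := le_mul_of_one_le_left hD0.le h1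
      _ = (4 * ε + 1) * ((1 - ε) ^ 3 * D) := by ring
      _ ≤ (4 * ε + 1) * r := mul_le_mul_of_nonneg_left r3 (by linarith)

/-- The radius costs `4 ε` and each order of evaluation adds at most four roundings, so every term
deviates by at most `(4 + 4.4) ε`. -/
theorem ComputedEntry.exists_eq {ε r : ℝ} {g w u v y : ℂ} (hε : 0 ≤ ε) (hε1 : ε ≤ 1 / 100)
    (hr : ComputedRadius ε g r) (h : ComputedEntry ε r w u v y) :
    ∃ a₁ a₂ : ℂ, ‖a₁ - 1‖ ≤ 10 * ε ∧ ‖a₂ - 1‖ ≤ 10 * ε ∧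
      y = invRadius g * (u * a₁ + w * v * a₂) := by
  obtain ⟨z, hz, hrz⟩ := hr.exists_eq hε hε1
  have hz' : ‖(z : ℂ) - 1‖ ≤ 4 * ε := by
    rw [← Complex.ofReal_one, ← Complex.ofReal_sub, Complex.norm_real]; exact hz
  have hrz' : (1 : ℂ) / (r : ℂ) = invRadius g * z := by
    rw [← Complex.ofReal_one, ← Complex.ofReal_div, hrz, Complex.ofReal_mul]
  have fin : ∀ {x : ℂ} {a : ℝ}, a ≤ 10 → ‖x - 1‖ ≤ a * ε → ‖x - 1‖ ≤ 10 * ε :=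
    fun ha hx => hx.trans (mul_le_mul_of_nonneg_right ha hε)
  have step : ∀ {x δ : ℂ} {a : ℝ}, a ≤ 10 → ‖x - 1‖ ≤ a * ε → ‖δ‖ ≤ ε →
      ‖x * (1 + δ) - 1‖ ≤ (a + 11 / 10) * ε :=
    fun ha hx hδ => norm_mul_one_add_sub_one_le hε1 ha hx hδ
  have conv : ∀ {δ : ℝ}, ‖δ‖ ≤ ε → ‖(δ : ℂ)‖ ≤ ε := fun h => by rwa [Complex.norm_real]
  rcases h with ⟨⟨δ₁, h₁, rfl⟩, ⟨δ₂, h₂, rfl⟩, ⟨δ₃, h₃, rfl⟩⟩ |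
    ⟨⟨δ₀, h₀, rfl⟩, ⟨δ₁, h₁, rfl⟩, ⟨δ₂, h₂, rfl⟩, ⟨δ₃, h₃, rfl⟩⟩ |
    ⟨⟨δ₀, h₀, rfl⟩, ⟨δ₁, h₁, rfl⟩, ⟨δ₂, h₂, rfl⟩, ⟨δ₃, h₃, rfl⟩, ⟨δ₄, h₄, rfl⟩⟩
  · have a := step (by norm_num) (step (by norm_num) hz' h₂) h₃
    refine ⟨_, _, fin (by norm_num) a, fin (by norm_num) (step (by norm_num) a h₁), ?_⟩
    rw [div_eq_mul_one_div, hrz']; ring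
  · have a := step (by norm_num) (step (by norm_num) (step (by norm_num) hz' (conv h₀)) h₂) h₃
    refine ⟨_, _, fin (by norm_num) a, fin (by norm_num) (step (by norm_num) a h₁), ?_⟩
    push_cast
    rw [hrz']; ring
  · have a := step (by norm_num) (step (by norm_num) hz' (conv h₀)) h₄
    refine ⟨_, _, fin (by norm_num) (step (by norm_num) a h₂),
      fin (by norm_num) (step (by norm_num) (step (by norm_num) a h₁) h₃), ?_⟩
    push_cast
    rw [hrz']; ring

theorem ComputedEntry.norm_sub_le {ε r : ℝ} {g w u v y : ℂ} (hε : 0 ≤ ε) (hε1 : ε ≤ 1 / 100)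
    (hr : ComputedRadius ε g r) (h : ComputedEntry ε r w u v y) :
    ‖y - invRadius g * (u + w * v)‖ ≤ 10 * ε * invRadius g * (‖u‖ + ‖w‖ * ‖v‖) := by
  obtain ⟨a₁, a₂, h1, h2, rfl⟩ := h.exists_eq hε hε1 hr
  have e : (invRadius g : ℂ) * (u * a₁ + w * v * a₂) - invRadius g * (u + w * v) =
      invRadius g * (u * (a₁ - 1) + w * v * (a₂ - 1)) := by ring
  have hρ := invRadius_pos g
  rw [e, norm_mul, Complex.norm_real, Real.norm_of_nonneg hρ.le]
  have h3 : ‖u * (a₁ - 1) + w * v * (a₂ - 1)‖ ≤ ‖u‖ * (10 * ε) + ‖w‖ * ‖v‖ * (10 * ε) := by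
    refine (norm_add_le _ _).trans (add_le_add ?_ ?_)
    · rw [norm_mul]; gcongr
    · rw [norm_mul, norm_mul]; gcongr
  calc _ ≤ invRadius g * (‖u‖ * (10 * ε) + ‖w‖ * ‖v‖ * (10 * ε)) := by gcongr
    _ = _ := by ring

/-- Since `v` is nearly `g u`, the entry is a positive multiple of `u (a₁ + |g|² a')` with `a₁` and
`a'` close to `1`; real parts rule out cancellation. -/
theorem ComputedEntry.ne_zero {ε r : ℝ} {g u v y : ℂ} (hε : 0 ≤ ε) (hε1 : ε ≤ 1 / 100)
    (hr : ComputedRadius ε g r) (hg : Rounded ε (v / u) g) (hu : u ≠ 0)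
    (h : ComputedEntry ε r (starRingEnd ℂ g) u v y) : y ≠ 0 := by
  obtain ⟨a₁, a₂, h1, h2, rfl⟩ := h.exists_eq hε hε1 hr
  obtain ⟨δ, hδ, hgδ⟩ := hg
  have hδ1 : 99 / 100 ≤ ‖1 + δ‖ := by
    have h := norm_sub_norm_le (1 : ℂ) (-δ)
    rw [norm_one, norm_neg, sub_neg_eq_add] at h
    linarith
  have hδ0 : 1 + δ ≠ 0 := norm_pos_iff.1 (by linarith)
  have hv : v = g * u / (1 + δ) := by rw [hgδ]; field_simp
  have key : u * a₁ + starRingEnd ℂ g * v * a₂ =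
      u * (a₁ + ((‖g‖ ^ 2 : ℝ) : ℂ) * (a₂ / (1 + δ))) := by
    have hgg : starRingEnd ℂ g * g = ((‖g‖ ^ 2 : ℝ) : ℂ) := by
      rw [mul_comm, Complex.mul_conj, Complex.normSq_eq_norm_sq]
    rw [hv, ← hgg]; field_simp
  have re_pos : ∀ x : ℂ, ‖x - 1‖ < 1 → 0 < x.re := fun x hx => by
    have h := (abs_le.1 (Complex.abs_re_le_norm (x - 1))).1
    rw [Complex.sub_re, Complex.one_re] at h
    linarith
  have p1 : 0 < a₁.re := re_pos _ (h1.trans_lt (by linarith))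
  have p2 : 0 < (a₂ / (1 + δ)).re := by
    refine re_pos _ ?_
    rw [div_sub_one hδ0, norm_div, div_lt_one (by linarith)]
    have h := _root_.norm_sub_le (a₂ - 1) δ
    rw [sub_sub] at h
    linarith
  rw [key]
  refine mul_ne_zero (Complex.ofReal_ne_zero.2 (invRadius_pos g).ne') (mul_ne_zero hu fun h0 => ?_)
  have h := congrArg Complex.re h0
  rw [Complex.add_re, Complex.re_ofReal_mul, Complex.zero_re] at h
  nlinarith [mul_nonneg (sq_nonneg ‖g‖) p2.le]

/-! ## The residual of a floating-point run -/

/-- The Euclidean norm of the coefficients of a pair of Laurent polynomials. -/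
noncomputable def pairNorm (u : ℂ[T;T⁻¹] × ℂ[T;T⁻¹]) : ℝ :=
  ‖WithLp.toLp 2 (toL2 u.1, toL2 u.2)‖

theorem pairNorm_sq (u : ℂ[T;T⁻¹] × ℂ[T;T⁻¹]) :
    pairNorm u ^ 2 = ‖toL2 u.1‖ ^ 2 + ‖toL2 u.2‖ ^ 2 := by
  rw [pairNorm, WithLp.prod_norm_sq_eq_of_L2]
  rfl

theorem pairNorm_nonneg (u : ℂ[T;T⁻¹] × ℂ[T;T⁻¹]) : 0 ≤ pairNorm u := norm_nonneg _

theorem pairNorm_add_le (u v : ℂ[T;T⁻¹] × ℂ[T;T⁻¹]) :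
    pairNorm (u + v) ≤ pairNorm u + pairNorm v := by
  simp only [pairNorm]
  refine le_trans (le_of_eq ?_) (norm_add_le _ _)
  simp [← WithLp.toLp_add]

theorem norm_fst_le_pairNorm (u : ℂ[T;T⁻¹] × ℂ[T;T⁻¹]) : ‖toL2 u.1‖ ≤ pairNorm u := by
  refine le_of_sq_le_sq ?_ (pairNorm_nonneg u)
  rw [pairNorm_sq]
  linarith [sq_nonneg ‖toL2 u.2‖]

theorem norm_snd_le_pairNorm (u : ℂ[T;T⁻¹] × ℂ[T;T⁻¹]) : ‖toL2 u.2‖ ≤ pairNorm u := by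
  refine le_of_sq_le_sq ?_ (pairNorm_nonneg u)
  rw [pairNorm_sq]
  linarith [sq_nonneg ‖toL2 u.1‖]

theorem pairNorm_le_add (u : ℂ[T;T⁻¹] × ℂ[T;T⁻¹]) :
    pairNorm u ≤ ‖toL2 u.1‖ + ‖toL2 u.2‖ := by
  refine le_of_sq_le_sq ?_ (by positivity)
  rw [pairNorm_sq]
  nlinarith [norm_nonneg (toL2 u.1), norm_nonneg (toL2 u.2)]

/-- Cauchy–Schwarz against `(1, ‖g‖)`, whose length is the inverse of `invRadius g`. Thus the
rounding error of a step is uniform in the size of `g`. -/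
theorem invRadius_mul_add_le (g : ℂ) (x y N : ℝ) (hN : 0 ≤ N) (h : x ^ 2 + y ^ 2 ≤ N ^ 2) :
    invRadius g * (x + ‖g‖ * y) ≤ N := by
  refine le_of_sq_le_sq ?_ hN
  have h1 := invRadius_sq_mul g
  have h2 : (x + ‖g‖ * y) ^ 2 ≤ (1 + ‖g‖ ^ 2) * (x ^ 2 + y ^ 2) := by
    nlinarith [sq_nonneg (y - ‖g‖ * x)]
  calc (invRadius g * (x + ‖g‖ * y)) ^ 2 = invRadius g ^ 2 * (x + ‖g‖ * y) ^ 2 := by ring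
    _ ≤ invRadius g ^ 2 * ((1 + ‖g‖ ^ 2) * (x ^ 2 + y ^ 2)) := by gcongr
    _ = x ^ 2 + y ^ 2 := by rw [← mul_assoc, h1, one_mul]
    _ ≤ N ^ 2 := h

/-- One step of the layer stripping algorithm, without the division of the first entry by `z`. -/
noncomputable def stripStep (g : ℂ) (k : ℤ) (u : ℂ[T;T⁻¹] × ℂ[T;T⁻¹]) :
    ℂ[T;T⁻¹] × ℂ[T;T⁻¹] :=
  (C (invRadius g : ℂ) * (u.1 - C g * (T k * u.2)),
    C (invRadius g : ℂ) * (u.2 + C (starRingEnd ℂ g) * (T (-k) * u.1)))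

theorem stripStep_sub (g : ℂ) (k : ℤ) (u v : ℂ[T;T⁻¹] × ℂ[T;T⁻¹]) :
    stripStep g k (u - v) = stripStep g k u - stripStep g k v := by
  ext1 <;> simp only [stripStep, Prod.fst_sub, Prod.snd_sub] <;> ring

theorem stripped_succ (g : ℕ → ℂ) (α b : ℂ[T;T⁻¹]) (k : ℕ) :
    stripped g α b (k + 1) = stripStep (g k) k (stripped g α b k) :=
  Prod.ext (stripped_fst_succ g α b k) (stripped_snd_succ g α b k)

theorem pairNorm_stripStep (g : ℂ) (k : ℤ) (u : ℂ[T;T⁻¹] × ℂ[T;T⁻¹]) :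
    pairNorm (stripStep g k u) = pairNorm u := by
  refine (pow_left_inj₀ (pairNorm_nonneg _) (pairNorm_nonneg _) two_ne_zero).1 ?_
  rw [pairNorm_sq, pairNorm_sq]
  have h : ((‖toL2 (stripStep g k u).1‖ ^ 2 : ℝ) : ℂ) + ((‖toL2 (stripStep g k u).2‖ ^ 2 : ℝ) : ℂ) =
      ((‖toL2 u.1‖ ^ 2 : ℝ) : ℂ) + ((‖toL2 u.2‖ ^ 2 : ℝ) : ℂ) := by
    simp only [norm_toL2_sq, ← Finsupp.add_apply, ← AddMonoidAlgebra.coeff_add]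
    congr 2
    simp only [stripStep, conjStar_mul, conjStar_add, conjStar_sub, conjStar_C, conjStar_T,
      Complex.conj_ofReal, Complex.conj_conj, neg_neg]
    have h1 := C_invRadius_mul g
    have h2 := T_mul_T_neg k
    linear_combination (conjStar u.1 * u.1 + conjStar u.2 * u.2) * h1 +
      (C (invRadius g : ℂ) * C (invRadius g : ℂ) * C g * C (starRingEnd ℂ g) *
        (conjStar u.1 * u.1 + conjStar u.2 * u.2)) * h2
  exact_mod_cast h

theorem norm_stripStep_fst_le (g : ℂ) (k : ℤ) (u : ℂ[T;T⁻¹] × ℂ[T;T⁻¹]) :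
    ‖toL2 (stripStep g k u).1‖ ≤ invRadius g * (‖toL2 u.1‖ + ‖g‖ * ‖toL2 u.2‖) := by
  have hρ := invRadius_pos g
  rw [stripStep, norm_toL2_C_mul, Complex.norm_real, Real.norm_of_nonneg hρ.le, map_sub]
  have h := norm_sub_le (toL2 u.1) (toL2 (C g * (T k * u.2)))
  rw [norm_toL2_C_mul, norm_toL2_T_mul] at h
  gcongr

/-- The Laurent polynomial whose coefficients of index in `s` are given by `c`, and whose other
coefficients vanish. -/
noncomputable def ofCoeffs (s : Finset ℤ) (c : ℤ → ℂ) : ℂ[T;T⁻¹] := ∑ i ∈ s, C (c i) * T i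

theorem coeff_ofCoeffs (s : Finset ℤ) (c : ℤ → ℂ) (j : ℤ) :
    (ofCoeffs s c).coeff j = if j ∈ s then c j else 0 := by
  rw [ofCoeffs, AddMonoidAlgebra.coeff_sum, Finset.sum_apply']
  simp only [coeff_C_mul, T_apply, mul_ite, mul_one, mul_zero, Finset.sum_ite_eq']

theorem sum_norm_coeff_sq_le (f : ℂ[T;T⁻¹]) (s : Finset ℤ) :
    ∑ i ∈ s, ‖f.coeff i‖ ^ 2 ≤ ‖toL2 f‖ ^ 2 := by
  rw [norm_toL2_sq_eq_sum f (s ∪ f.coeff.support)]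
  · exact Finset.sum_le_sum_of_subset_of_nonneg Finset.subset_union_left fun _ _ _ => sq_nonneg _
  · intro k hk
    simp only [Finset.mem_union, not_or] at hk
    exact Finsupp.notMem_support_iff.1 hk.2

theorem norm_ofCoeffs_le (s : Finset ℤ) (c : ℤ → ℂ) (f h : ℂ[T;T⁻¹]) (κ m : ℝ) (hκ : 0 ≤ κ)
    (hm : 0 ≤ m) (hc : ∀ i ∈ s, ‖c i‖ ≤ κ * (‖f.coeff i‖ + m * ‖h.coeff i‖)) :
    ‖toL2 (ofCoeffs s c)‖ ≤ 2 * κ * (‖toL2 f‖ + m * ‖toL2 h‖) := by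
  refine le_of_sq_le_sq ?_ (by positivity)
  rw [norm_toL2_sq_eq_sum _ s (fun k hk => by rw [coeff_ofCoeffs, if_neg hk])]
  have h1 : ∀ i ∈ s, ‖(ofCoeffs s c).coeff i‖ ^ 2 ≤
      2 * κ ^ 2 * ‖f.coeff i‖ ^ 2 + 2 * κ ^ 2 * m ^ 2 * ‖h.coeff i‖ ^ 2 := by
    intro i hi
    rw [coeff_ofCoeffs, if_pos hi]
    have h2 := pow_le_pow_left₀ (norm_nonneg _) (hc i hi) 2
    have h3 : (‖f.coeff i‖ + m * ‖h.coeff i‖) ^ 2 ≤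
        2 * (‖f.coeff i‖ ^ 2 + m ^ 2 * ‖h.coeff i‖ ^ 2) := by
      nlinarith [sq_nonneg (‖f.coeff i‖ - m * ‖h.coeff i‖)]
    calc ‖c i‖ ^ 2 ≤ κ ^ 2 * (‖f.coeff i‖ + m * ‖h.coeff i‖) ^ 2 := by rw [← mul_pow]; exact h2
      _ ≤ κ ^ 2 * (2 * (‖f.coeff i‖ ^ 2 + m ^ 2 * ‖h.coeff i‖ ^ 2)) := by gcongr
      _ = _ := by ring
  refine (Finset.sum_le_sum h1).trans ?_
  rw [Finset.sum_add_distrib, ← Finset.mul_sum, ← Finset.mul_sum]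
  have h4 : 2 * κ ^ 2 * ∑ i ∈ s, ‖f.coeff i‖ ^ 2 ≤ 2 * κ ^ 2 * ‖toL2 f‖ ^ 2 := by
    gcongr; exact sum_norm_coeff_sq_le f s
  have h5 : 2 * κ ^ 2 * m ^ 2 * ∑ i ∈ s, ‖h.coeff i‖ ^ 2 ≤ 2 * κ ^ 2 * m ^ 2 * ‖toL2 h‖ ^ 2 := by
    gcongr; exact sum_norm_coeff_sq_le h s
  have h6 : 0 ≤ κ ^ 2 * (‖toL2 f‖ * (m * ‖toL2 h‖)) := by positivity
  nlinarith [sq_nonneg (κ * ‖toL2 f‖), sq_nonneg (κ * (m * ‖toL2 h‖))]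

/-- The vectors of a floating-point run as Laurent polynomials, the first one multiplied by `z ^ k`.
The coefficients that the algorithm drops are kept and updated in exact arithmetic. -/
noncomputable def runPair (n : ℕ) (α b : ℂ[T;T⁻¹]) (A B : ℕ → ℕ → ℂ) (g : ℕ → ℂ) :
    ℕ → ℂ[T;T⁻¹] × ℂ[T;T⁻¹]
  | 0 => (b, α)
  | k + 1 => stripStep (g k) k (runPair n α b A B g k) +
    (ofCoeffs (Finset.Ico k n) fun i => (if i = k then 0 else B (k + 1) (i - (k + 1)).toNat) -
        (stripStep (g k) k (runPair n α b A B g k)).1.coeff i,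
     ofCoeffs (Finset.Ico 0 (n - (k + 1))) fun i => A (k + 1) i.toNat -
        (stripStep (g k) k (runPair n α b A B g k)).2.coeff i)

section Run

variable {n : ℕ} {α b : ℂ[T;T⁻¹]} {A B : ℕ → ℕ → ℂ} {g : ℕ → ℂ} {r : ℕ → ℝ} {ε : ℝ}

/-- The vectors of the run are read off from `runPair`. -/
structure RunInvariant (n : ℕ) (α b : ℂ[T;T⁻¹]) (A B : ℕ → ℕ → ℂ) (g : ℕ → ℂ) (k : ℕ) : Prop where
  fst : OrderGE k (runPair n α b A B g k).1
  snd : OrderGE 0 (runPair n α b A B g k).2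
  coeff_fst : ∀ j : ℕ, k + j < n → (runPair n α b A B g k).1.coeff (k + j) = B k j
  coeff_snd : ∀ j : ℕ, k + j < n → (runPair n α b A B g k).2.coeff j = A k j

/-- An exact rotation preserves order `k`; the coefficient at index `k` is overwritten by `0`, which
raises the order to `k + 1`. -/
theorem runInvariant (hα : OrderGE 0 α) (hb : OrderGE 0 b)
    (h : LayerStrippingRun ε n (fun j => α.coeff j) (fun j => b.coeff j) A B g r) :
    ∀ k ≤ n, RunInvariant n α b A B g k := by
  intro k
  induction k with
  | zero =>
    intro _
    refine ⟨hb, hα, fun j hj => ?_, fun j hj => ?_⟩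
    · simpa [runPair] using (h.init_b j (by omega)).symm
    · simpa [runPair] using (h.init_a j (by omega)).symm
  | succ k ih =>
    intro hk
    obtain ⟨h1, h2, -, -⟩ := ih (by omega)
    have c1 : ∀ i : ℤ, (runPair n α b A B g (k + 1)).1.coeff i = if i ∈ Finset.Ico (k : ℤ) n then
        (if i = k then 0 else B (k + 1) (i - (k + 1)).toNat) else
        (stripStep (g k) k (runPair n α b A B g k)).1.coeff i := by
      intro i
      rw [runPair, Prod.fst_add, AddMonoidAlgebra.coeff_add, Finsupp.add_apply, coeff_ofCoeffs]
      split_ifs <;> ring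
    have c2 : ∀ i : ℤ, (runPair n α b A B g (k + 1)).2.coeff i =
        if i ∈ Finset.Ico (0 : ℤ) (n - (k + 1)) then A (k + 1) i.toNat else
        (stripStep (g k) k (runPair n α b A B g k)).2.coeff i := by
      intro i
      rw [runPair, Prod.snd_add, AddMonoidAlgebra.coeff_add, Finsupp.add_apply, coeff_ofCoeffs]
      split_ifs <;> ring
    have o1 : OrderGE k (stripStep (g k) k (runPair n α b A B g k)).1 :=
      (h1.sub (((h2.T_mul k).mono (by omega)).C_mul _)).C_mul _
    have o2 : OrderGE 0 (stripStep (g k) k (runPair n α b A B g k)).2 :=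
      (h2.add (((h1.T_mul (-k)).mono (by omega)).C_mul _)).C_mul _
    refine ⟨fun i hi => ?_, fun i hi => ?_, fun j hj => ?_, fun j hj => ?_⟩
    · rw [c1]
      push_cast at hi
      by_cases hik : i = k
      · rw [if_pos (Finset.mem_Ico.2 (by omega)), if_pos hik]
      · rw [if_neg (by rw [Finset.mem_Ico]; omega), o1 i (by omega)]
    · rw [c2, if_neg (by rw [Finset.mem_Ico]; omega), o2 i hi]
    · rw [c1, if_pos (Finset.mem_Ico.2 (by push_cast; omega)), if_neg (by push_cast; omega)]
      congr 1
      push_cast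
      omega
    · rw [c2, if_pos (Finset.mem_Ico.2 (by omega)), Int.toNat_natCast]

theorem LayerStrippingRun.ne_zero (hε : 0 ≤ ε) (hε1 : ε ≤ 1 / 100) (h0 : α.coeff 0 ≠ 0)
    (h : LayerStrippingRun ε n (fun j => α.coeff j) (fun j => b.coeff j) A B g r) :
    ∀ k < n, A k 0 ≠ 0 := by
  intro k
  induction k with
  | zero => intro hk; rw [h.init_a 0 hk]; simpa using h0
  | succ k ih =>
    intro hk
    exact (h.step_a k 0 (by omega)).ne_zero hε hε1 (h.radius k hk) (h.coefficient k (by omega))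
      (ih (by omega))

/-- Only stored coefficients deviate from the exact rotation, each by a rounding error relative to
the two entries it comes from. -/
theorem norm_runPair_error_le (hε : 0 ≤ ε) (hε1 : ε ≤ 1 / 100) (hα : OrderGE 0 α)
    (hb : OrderGE 0 b) (h0 : α.coeff 0 ≠ 0)
    (h : LayerStrippingRun ε n (fun j => α.coeff j) (fun j => b.coeff j) A B g r) {k : ℕ}
    (hk : k < n) :
    ‖toL2 (runPair n α b A B g (k + 1) - stripStep (g k) k (runPair n α b A B g k)).1‖ ≤
      20 * ε * (invRadius (g k) * (‖toL2 (runPair n α b A B g k).1‖ +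
        ‖g k‖ * ‖toL2 (runPair n α b A B g k).2‖)) ∧
    ‖toL2 (runPair n α b A B g (k + 1) - stripStep (g k) k (runPair n α b A B g k)).2‖ ≤
      20 * ε * (invRadius (g k) * (‖toL2 (runPair n α b A B g k).2‖ +
        ‖g k‖ * ‖toL2 (runPair n α b A B g k).1‖)) := by
  have inv := runInvariant hα hb h k hk.le
  have hA := h.ne_zero hε hε1 h0 k hk
  have hρ := invRadius_pos (g k)
  rw [runPair, add_sub_cancel_left]
  obtain ⟨i1, i2, i3, i4⟩ := inv
  generalize runPair n α b A B g k = u at *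
  obtain ⟨W, V⟩ := u
  simp only at *
  constructor
  · have := norm_ofCoeffs_le (Finset.Ico (k : ℤ) n)
      (fun i => (if i = k then 0 else B (k + 1) (i - (k + 1)).toNat) -
        (stripStep (g k) k (W, V)).1.coeff i) W (T k * V) (10 * ε * invRadius (g k)) ‖g k‖
        (by positivity) (norm_nonneg _) ?_
    · rw [norm_toL2_T_mul] at this
      linarith
    · intro i hi
      rw [Finset.mem_Ico] at hi
      obtain ⟨j, rfl⟩ : ∃ j : ℕ, i = k + j := ⟨(i - k).toNat, by omega⟩
      have hs : (stripStep (g k) k (W, V)).1.coeff (k + j) =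
          invRadius (g k) * (B k j + -g k * A k j) := by
        rw [stripStep, coeff_C_mul, AddMonoidAlgebra.coeff_sub, Finsupp.sub_apply, coeff_C_mul,
          coeff_T_mul, add_sub_cancel_left, i3 j (by omega), i4 j (by omega)]
        ring
      rw [hs, coeff_T_mul, add_sub_cancel_left, i3 j (by omega), i4 j (by omega)]
      -- For `j = 0` the entry is set to zero, not computed. What is discarded is `-B k 0 * δ` up to
      -- scaling, since `g k` is a rounded quotient with nonzero denominator.
      rcases j with _ | j
      · rw [if_pos (by simp), zero_sub, norm_neg, norm_mul, Complex.norm_real,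
          Real.norm_of_nonneg hρ.le]
        obtain ⟨δ, hδ, hg⟩ := h.coefficient k hk
        have e : B k 0 + -g k * A k 0 = -(B k 0 * δ) := by rw [hg]; field_simp; ring
        rw [e, norm_neg, norm_mul]
        have p1 := norm_nonneg (B k 0)
        have p2 := mul_nonneg (norm_nonneg (g k)) (norm_nonneg (A k 0))
        have p3 : ‖B k 0‖ * ‖δ‖ ≤ 10 * ε * (‖B k 0‖ + ‖g k‖ * ‖A k 0‖) := by
          nlinarith [mul_le_mul_of_nonneg_left hδ p1, mul_nonneg hε p1, mul_nonneg hε p2]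
        calc _ ≤ invRadius (g k) * (10 * ε * (‖B k 0‖ + ‖g k‖ * ‖A k 0‖)) := by gcongr
          _ = _ := by ring
      · rw [if_neg (by push_cast; omega)]
        have e : ((k : ℤ) + ((j + 1 : ℕ) : ℤ) - (k + 1)).toNat = j := by omega
        have := (h.step_b k j (by omega)).norm_sub_le hε hε1 (h.radius k (by omega))
        rw [norm_neg] at this
        rwa [e]
  · have := norm_ofCoeffs_le (Finset.Ico (0 : ℤ) (n - (k + 1)))
      (fun i => A (k + 1) i.toNat - (stripStep (g k) k (W, V)).2.coeff i) V (T (-k) * W)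
        (10 * ε * invRadius (g k)) ‖g k‖ (by positivity) (norm_nonneg _) ?_
    · rw [norm_toL2_T_mul] at this
      linarith
    · intro i hi
      rw [Finset.mem_Ico] at hi
      obtain ⟨j, rfl⟩ : ∃ j : ℕ, i = j := ⟨i.toNat, by omega⟩
      have e : (j : ℤ) - -(k : ℤ) = k + j := by ring
      have hs : (stripStep (g k) k (W, V)).2.coeff j =
          invRadius (g k) * (A k j + starRingEnd ℂ (g k) * B k j) := by
        rw [stripStep, coeff_C_mul, AddMonoidAlgebra.coeff_add, Finsupp.add_apply, coeff_C_mul,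
          coeff_T_mul, e, i3 j (by omega), i4 j (by omega)]
      rw [hs, coeff_T_mul, e, i3 j (by omega), i4 j (by omega), Int.toNat_natCast]
      have := (h.step_a k j (by omega)).norm_sub_le hε hε1 (h.radius k (by omega))
      rwa [RCLike.norm_conj] at this

/-- The residual of a run: `runPair` is up to this error what exact arithmetic obtains from the
initial data with the computed coefficients. -/
noncomputable def runResidual (n : ℕ) (α b : ℂ[T;T⁻¹]) (A B : ℕ → ℕ → ℂ) (g : ℕ → ℂ) (k : ℕ) :
    ℂ[T;T⁻¹] × ℂ[T;T⁻¹] :=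
  runPair n α b A B g k - stripped g α b k

theorem runResidual_succ (k : ℕ) : runResidual n α b A B g (k + 1) =
    stripStep (g k) k (runResidual n α b A B g k) +
      (runPair n α b A B g (k + 1) - stripStep (g k) k (runPair n α b A B g k)) := by
  rw [runResidual, runResidual, stripStep_sub, stripped_succ]
  abel

theorem runResidual_zero : runResidual n α b A B g 0 = 0 := by
  simp [runResidual, runPair, stripped, partialPair]

theorem pairNorm_runPair_error_le (hε : 0 ≤ ε) (hε1 : ε ≤ 1 / 100) (hα : OrderGE 0 α)
    (hb : OrderGE 0 b) (h0 : α.coeff 0 ≠ 0)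
    (h : LayerStrippingRun ε n (fun j => α.coeff j) (fun j => b.coeff j) A B g r) {k : ℕ}
    (hk : k < n) :
    pairNorm (runPair n α b A B g (k + 1) - stripStep (g k) k (runPair n α b A B g k)) ≤
      40 * ε * pairNorm (runPair n α b A B g k) := by
  obtain ⟨h1, h2⟩ := norm_runPair_error_le hε hε1 hα hb h0 h hk
  have h3 := pairNorm_le_add
    (runPair n α b A B g (k + 1) - stripStep (g k) k (runPair n α b A B g k))
  have h4 := invRadius_mul_add_le (g k) _ _ _ (pairNorm_nonneg (runPair n α b A B g k))
    (pairNorm_sq (runPair n α b A B g k)).ge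
  have h5 := invRadius_mul_add_le (g k) _ _ _ (pairNorm_nonneg (runPair n α b A B g k))
    (((add_comm _ _).trans (pairNorm_sq (runPair n α b A B g k)).symm).le)
  have h6 := mul_le_mul_of_nonneg_left h4 (by linarith : 0 ≤ 20 * ε)
  have h7 := mul_le_mul_of_nonneg_left h5 (by linarith : 0 ≤ 20 * ε)
  linarith

theorem pairNorm_runPair_le (hε : 0 ≤ ε) (hε1 : ε ≤ 1 / 100) (hα : OrderGE 0 α)
    (hb : OrderGE 0 b) (h0 : α.coeff 0 ≠ 0) (h1 : pairNorm (b, α) ≤ 1) (hn : 80 * (n * ε) ≤ 1)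
    (h : LayerStrippingRun ε n (fun j => α.coeff j) (fun j => b.coeff j) A B g r) :
    ∀ k ≤ n, pairNorm (runPair n α b A B g k) ≤ 1 + 80 * ε * k := by
  intro k
  induction k with
  | zero => intro _; simpa [runPair] using h1
  | succ k ih =>
    intro hk
    have i1 := ih (by omega)
    have i2 := pairNorm_runPair_error_le hε hε1 hα hb h0 h (k := k) (by omega)
    have i3 := pairNorm_add_le (stripStep (g k) k (runPair n α b A B g k))
      (runPair n α b A B g (k + 1) - stripStep (g k) k (runPair n α b A B g k))
    rw [add_sub_cancel, pairNorm_stripStep] at i3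
    have i4 : ε * k ≤ n * ε := by
      rw [mul_comm]
      exact mul_le_mul_of_nonneg_right (by exact_mod_cast (by omega : k ≤ n)) hε
    have i5 : ε * pairNorm (runPair n α b A B g k) ≤ ε * 2 :=
      mul_le_mul_of_nonneg_left (by linarith) hε
    push_cast
    linarith

theorem pairNorm_runPair_le_two (hε : 0 ≤ ε) (hε1 : ε ≤ 1 / 100) (hα : OrderGE 0 α)
    (hb : OrderGE 0 b) (h0 : α.coeff 0 ≠ 0) (h1 : pairNorm (b, α) ≤ 1) (hn : 80 * (n * ε) ≤ 1)
    (h : LayerStrippingRun ε n (fun j => α.coeff j) (fun j => b.coeff j) A B g r) {k : ℕ}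
    (hk : k ≤ n) : pairNorm (runPair n α b A B g k) ≤ 2 := by
  have i1 := pairNorm_runPair_le hε hε1 hα hb h0 h1 hn h k hk
  have i4 : k * ε ≤ n * ε := mul_le_mul_of_nonneg_right (by exact_mod_cast hk) hε
  linarith

/-- The rotation is an isometry, so each step adds at most `40 ε` times the norm of the running
vector, which is at most `2`. -/
theorem pairNorm_runResidual_le (hε : 0 ≤ ε) (hε1 : ε ≤ 1 / 100) (hα : OrderGE 0 α)
    (hb : OrderGE 0 b) (h0 : α.coeff 0 ≠ 0) (h1 : pairNorm (b, α) ≤ 1) (hn : 80 * (n * ε) ≤ 1)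
    (h : LayerStrippingRun ε n (fun j => α.coeff j) (fun j => b.coeff j) A B g r) :
    ∀ k ≤ n, pairNorm (runResidual n α b A B g k) ≤ 80 * ε * k := by
  intro k
  induction k with
  | zero => intro _; rw [runResidual_zero]; simp [pairNorm]
  | succ k ih =>
    intro hk
    have i1 := ih (by omega)
    have i2 := pairNorm_runPair_error_le hε hε1 hα hb h0 h (k := k) (by omega)
    have i3 := pairNorm_add_le (stripStep (g k) k (runResidual n α b A B g k))
      (runPair n α b A B g (k + 1) - stripStep (g k) k (runPair n α b A B g k))
    rw [← runResidual_succ, pairNorm_stripStep] at i3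
    have i4 := pairNorm_runPair_le_two hε hε1 hα hb h0 h1 hn h (k := k) (by omega)
    have i5 : ε * pairNorm (runPair n α b A B g k) ≤ ε * 2 := mul_le_mul_of_nonneg_left i4 hε
    push_cast
    linarith

/-- The first component starts at `b` and is fed by the second only through `g j`, so it stays small
when the data are small. -/
theorem norm_runPair_fst_le (hε : 0 ≤ ε) (hε1 : ε ≤ 1 / 100) (hα : OrderGE 0 α)
    (hb : OrderGE 0 b) (h0 : α.coeff 0 ≠ 0) (h1 : pairNorm (b, α) ≤ 1) (hn : 80 * (n * ε) ≤ 1)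
    (h : LayerStrippingRun ε n (fun j => α.coeff j) (fun j => b.coeff j) A B g r) :
    ∀ k ≤ n, ‖toL2 (runPair n α b A B g k).1‖ ≤
      (1 + 40 * ε * k) * (‖toL2 b‖ + 2 * ∑ j ∈ Finset.range k, ‖g j‖) := by
  intro k
  induction k with
  | zero => intro _; simp [runPair]
  | succ k ih =>
    intro hk
    have i1 := ih (by omega)
    have i2 := (norm_runPair_error_le hε hε1 hα hb h0 h (k := k) (by omega)).1
    have i3 := norm_stripStep_fst_le (g k) k (runPair n α b A B g k)
    have i4 := (norm_snd_le_pairNorm _).trans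
      (pairNorm_runPair_le_two hε hε1 hα hb h0 h1 hn h (k := k) (by omega))
    have i5 : ‖toL2 (runPair n α b A B g (k + 1)).1‖ ≤
        ‖toL2 (stripStep (g k) k (runPair n α b A B g k)).1‖ + ‖toL2 (runPair n α b A B g (k + 1) -
          stripStep (g k) k (runPair n α b A B g k)).1‖ := by
      refine le_trans (le_of_eq ?_) (norm_add_le _ _)
      rw [← map_add, Prod.fst_sub, add_sub_cancel]
    have i6 : k * ε ≤ n * ε :=
      mul_le_mul_of_nonneg_right (by exact_mod_cast (by omega : k ≤ n)) hε
    have i7 : invRadius (g k) * (‖toL2 (runPair n α b A B g k).1‖ +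
        ‖g k‖ * ‖toL2 (runPair n α b A B g k).2‖) ≤
        ‖toL2 (runPair n α b A B g k).1‖ + ‖g k‖ * 2 := by
      refine (mul_le_of_le_one_left (by positivity) (invRadius_le_one _)).trans ?_
      gcongr
    rw [Finset.sum_range_succ]
    set S := ‖toL2 b‖ + 2 * ∑ j ∈ Finset.range k, ‖g j‖ with hS
    have hS0 : 0 ≤ S := by positivity
    have hgk := norm_nonneg (g k)
    set x := invRadius (g k) * (‖toL2 (runPair n α b A B g k).1‖ +
        ‖g k‖ * ‖toL2 (runPair n α b A B g k).2‖) with hx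
    have hkε : 0 ≤ ε * k := by positivity
    have i8 : x ≤ (1 + 40 * ε * k) * (S + 2 * ‖g k‖) := by nlinarith
    have i9 : (1 + 20 * ε) * (1 + 40 * ε * k) ≤ 1 + 40 * ε * (k + 1) := by nlinarith
    calc ‖toL2 (runPair n α b A B g (k + 1)).1‖ ≤ (1 + 20 * ε) * x := by linarith
      _ ≤ (1 + 20 * ε) * ((1 + 40 * ε * k) * (S + 2 * ‖g k‖)) := by gcongr
      _ = (1 + 20 * ε) * (1 + 40 * ε * k) * (S + 2 * ‖g k‖) := by ring
      _ ≤ (1 + 40 * ε * (k + 1)) * (S + 2 * ‖g k‖) := by gcongr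
      _ = _ := by rw [hS]; push_cast; ring

/-- Refines the uniform bound for relative accuracy: fresh errors scale with the first component or
with `g j`, and old errors of the second component enter multiplied by `g j`. -/
theorem norm_runResidual_fst_le (hε : 0 ≤ ε) (hε1 : ε ≤ 1 / 100) (hα : OrderGE 0 α)
    (hb : OrderGE 0 b) (h0 : α.coeff 0 ≠ 0) (h1 : pairNorm (b, α) ≤ 1) (hn : 80 * (n * ε) ≤ 1)
    (h : LayerStrippingRun ε n (fun j => α.coeff j) (fun j => b.coeff j) A B g r) :
    ∀ k ≤ n, ‖toL2 (runResidual n α b A B g k).1‖ ≤ 200 * (n * ε) *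
      (‖toL2 b‖ + ∑ j ∈ Finset.range n, ‖g j‖) := by
  set S := ∑ j ∈ Finset.range n, ‖g j‖ with hS
  have hS0 : 0 ≤ S := by positivity
  have hb0 := norm_nonneg (toL2 b)
  have key : ∀ k ≤ n, ‖toL2 (runResidual n α b A B g k).1‖ ≤
      (80 * (n * ε) + 40 * ε) * ∑ j ∈ Finset.range k, ‖g j‖ +
        40 * ε * k * (‖toL2 b‖ + 2 * S) := by
    intro k
    induction k with
    | zero => intro _; rw [runResidual_zero]; simp
    | succ k ih =>
      intro hk
      have hkn : k ≤ n := by omega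
      have i1 := ih hkn
      have i2 := (norm_runPair_error_le hε hε1 hα hb h0 h (k := k) (by omega)).1
      have i3 := norm_stripStep_fst_le (g k) k (runResidual n α b A B g k)
      have i4 := (norm_snd_le_pairNorm _).trans
        (pairNorm_runPair_le_two hε hε1 hα hb h0 h1 hn h hkn)
      have i5 := (norm_snd_le_pairNorm _).trans
        (pairNorm_runResidual_le hε hε1 hα hb h0 h1 hn h k hkn)
      have i6 := norm_runPair_fst_le hε hε1 hα hb h0 h1 hn h k hkn
      have i7 : ‖toL2 (runResidual n α b A B g (k + 1)).1‖ ≤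
          ‖toL2 (stripStep (g k) k (runResidual n α b A B g k)).1‖ +
          ‖toL2 (runPair n α b A B g (k + 1) -
            stripStep (g k) k (runPair n α b A B g k)).1‖ := by
        rw [runResidual_succ, Prod.fst_add, map_add]
        exact norm_add_le _ _
      have hkε : k * ε ≤ n * ε := mul_le_mul_of_nonneg_right (by exact_mod_cast hkn) hε
      have hkε0 : 0 ≤ k * ε := by positivity
      have hgk := norm_nonneg (g k)
      have hSk : ∑ j ∈ Finset.range k, ‖g j‖ ≤ S :=
        Finset.sum_le_sum_of_subset_of_nonneg (Finset.range_mono hkn) fun _ _ _ => norm_nonneg _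
      have hSk0 : 0 ≤ ∑ j ∈ Finset.range k, ‖g j‖ := by positivity
      have i8 : ‖toL2 (runPair n α b A B g k).1‖ ≤ 2 * (‖toL2 b‖ + 2 * S) := by
        refine i6.trans ?_
        gcongr
        linarith
      have i9 : invRadius (g k) * (‖toL2 (runPair n α b A B g k).1‖ +
          ‖g k‖ * ‖toL2 (runPair n α b A B g k).2‖) ≤ 2 * (‖toL2 b‖ + 2 * S) + ‖g k‖ * 2 := by
        refine (mul_le_of_le_one_left (by positivity) (invRadius_le_one _)).trans ?_
        gcongr
      have i10 : invRadius (g k) * (‖toL2 (runResidual n α b A B g k).1‖ +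
          ‖g k‖ * ‖toL2 (runResidual n α b A B g k).2‖) ≤
          ‖toL2 (runResidual n α b A B g k).1‖ + ‖g k‖ * (80 * (n * ε)) := by
        refine (mul_le_of_le_one_left (by positivity) (invRadius_le_one _)).trans ?_
        gcongr
        linarith
      have i11 := mul_le_mul_of_nonneg_left i9 (by linarith : 0 ≤ 20 * ε)
      rw [Finset.sum_range_succ]
      push_cast
      nlinarith
  intro k hk
  refine (key k hk).trans ?_
  have hkε : k * ε ≤ n * ε := mul_le_mul_of_nonneg_right (by exact_mod_cast hk) hε
  have hkε0 : 0 ≤ k * ε := by positivity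
  have hSk : ∑ j ∈ Finset.range k, ‖g j‖ ≤ S :=
    Finset.sum_le_sum_of_subset_of_nonneg (Finset.range_mono hk) fun _ _ _ => norm_nonneg _
  have hnε : 0 ≤ n * ε := by positivity
  rcases Nat.eq_zero_or_pos n with rfl | hpos
  · obtain rfl : k = 0 := by omega
    simp
  have hε' : ε ≤ n * ε := le_mul_of_one_le_left hε (by exact_mod_cast hpos)
  calc (80 * (n * ε) + 40 * ε) * ∑ j ∈ Finset.range k, ‖g j‖ + 40 * ε * k * (‖toL2 b‖ + 2 * S)
      = (80 * (n * ε) + 40 * ε) * ∑ j ∈ Finset.range k, ‖g j‖ +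
          40 * (k * ε) * (‖toL2 b‖ + 2 * S) := by ring
    _ ≤ (80 * (n * ε) + 40 * (n * ε)) * S + 40 * (n * ε) * (‖toL2 b‖ + 2 * S) := by gcongr
    _ ≤ _ := by nlinarith [mul_nonneg hnε hb0]

theorem LayerStrippingRun.exists_residual (hε : 0 ≤ ε) (hε1 : ε ≤ 1 / 100) (hα : OrderGE 0 α)
    (hb : OrderGE 0 b) (h0 : α.coeff 0 ≠ 0) (h1 : pairNorm (b, α) ≤ 1) (hn : 80 * (n * ε) ≤ 1)
    (h : LayerStrippingRun ε n (fun j => α.coeff j) (fun j => b.coeff j) A B g r) {k : ℕ}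
    (hk : k ≤ n) : ∃ R₁ R₂ : ℂ[T;T⁻¹], OrderGE k ((stripped g α b k).1 + R₁) ∧
      OrderGE 0 ((stripped g α b k).2 + R₂) ∧
      ‖toL2 R₁‖ ≤ 200 * (n * ε) * (‖toL2 b‖ + ∑ j ∈ Finset.range n, ‖g j‖) ∧
      ‖toL2 R₁‖ ≤ 80 * (n * ε) ∧ ‖toL2 R₂‖ ≤ 80 * (n * ε) := by
  have inv := runInvariant hα hb h k hk
  have hR := pairNorm_runResidual_le hε hε1 hα hb h0 h1 hn h k hk
  have hkε : k * ε ≤ n * ε := mul_le_mul_of_nonneg_right (by exact_mod_cast hk) hε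
  have hR' : pairNorm (runResidual n α b A B g k) ≤ 80 * (n * ε) := by linarith
  refine ⟨(runResidual n α b A B g k).1, (runResidual n α b A B g k).2, ?_, ?_,
    norm_runResidual_fst_le hε hε1 hα hb h0 h1 hn h k hk,
    (norm_fst_le_pairNorm _).trans hR', (norm_snd_le_pairNorm _).trans hR'⟩
  · rw [runResidual, Prod.fst_sub, add_sub_cancel]; exact inv.fst
  · rw [runResidual, Prod.snd_sub, add_sub_cancel]; exact inv.snd

end Run

/-! ## The support of the inverse nonlinear Fourier transform -/

theorem nlftFactor_eq (g : ℂ) (k : ℤ) : nlftFactor g k =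
    !![C (invRadius g : ℂ), C (invRadius g : ℂ) * (C g * T k);
      -(C (invRadius g : ℂ) * (C (starRingEnd ℂ g) * T (-k))), C (invRadius g : ℂ)] := by
  rw [nlftFactor]
  ext i j
  fin_cases i <;> fin_cases j <;> simp [invRadius]

theorem nlftFactor_zero (k : ℤ) : nlftFactor 0 k = 1 := by
  rw [nlftFactor_eq, Matrix.one_fin_two]
  simp [invRadius]

theorem nlftFactor_mul_apply_zero_one (g : ℂ) (k : ℤ) (M : Matrix (Fin 2) (Fin 2) ℂ[T;T⁻¹]) :
    (nlftFactor g k * M) 0 1 = C (invRadius g : ℂ) * (M 0 1 + C g * (T k * M 1 1)) := by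
  rw [nlftFactor_eq, Matrix.mul_apply, Fin.sum_univ_two]
  simp only [Matrix.of_apply, Matrix.cons_val', Matrix.cons_val_zero, Matrix.cons_val_one,
    Matrix.cons_val_fin_one]
  ring

theorem nlftFactor_mul_apply_one_one (g : ℂ) (k : ℤ) (M : Matrix (Fin 2) (Fin 2) ℂ[T;T⁻¹]) :
    (nlftFactor g k * M) 1 1 =
      C (invRadius g : ℂ) * (M 1 1 - C (starRingEnd ℂ g) * (T (-k) * M 0 1)) := by
  rw [nlftFactor_eq, Matrix.mul_apply, Fin.sum_univ_two]
  simp only [Matrix.of_apply, Matrix.cons_val', Matrix.cons_val_zero, Matrix.cons_val_one,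
    Matrix.cons_val_fin_one]
  ring

/-- The factors are peeled off from the left, in increasing order, so each new index lies below the
order of the off-diagonal entry and cannot disturb the constant coefficient on the diagonal. -/
theorem orderGE_prod_nlftFactor (γ : ℤ → ℂ) (l : List ℤ) (hl : l.Pairwise (· < ·)) :
    ∀ m : ℤ, (∀ k ∈ l, m ≤ k) →
      OrderGE m ((l.map fun k => nlftFactor (γ k) k).prod 0 1) ∧
      OrderGE 0 ((l.map fun k => nlftFactor (γ k) k).prod 1 1) ∧
      ((l.map fun k => nlftFactor (γ k) k).prod 1 1).coeff 0 ≠ 0 := by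
  induction l with
  | nil =>
    intro m _
    refine ⟨fun k _ => by simp, by simpa using OrderGE.one, by simp⟩
  | cons k l ih =>
    intro m hm
    rw [List.pairwise_cons] at hl
    obtain ⟨h1, h2, h3⟩ := ih hl.2 (k + 1) fun j hj => hl.1 j hj
    have hmk := hm k List.mem_cons_self
    rw [List.map_cons, List.prod_cons, nlftFactor_mul_apply_zero_one, nlftFactor_mul_apply_one_one]
    have h4 := h1.T_mul (-k)
    refine ⟨((h1.mono (by omega)).add (((h2.T_mul k).mono (by omega)).C_mul _)).C_mul _,
      (h2.sub ((h4.mono (by omega)).C_mul _)).C_mul _, ?_⟩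
    rw [coeff_C_mul, AddMonoidAlgebra.coeff_sub, Finsupp.sub_apply, coeff_C_mul,
      h4 0 (by omega), mul_zero, sub_zero]
    exact mul_ne_zero (Complex.ofReal_ne_zero.2 (invRadius_pos _).ne') h3

/-- At the least index `m` of the support, the coefficient of `b` is a nonzero multiple of `γ m`. -/
theorem IsInverseNLFT.nonneg_of_ne_zero {γ : ℤ →₀ ℂ} {a b : ℂ[T;T⁻¹]} (h : IsInverseNLFT γ a b)
    (hb : OrderGE 0 b) {k : ℤ} (hk : γ k ≠ 0) : 0 ≤ k := by
  have hb' : nlft γ 0 1 = b := by rw [h]; rfl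
  have hmem : ∀ j, j ∈ γ.support.sort (· ≤ ·) ↔ γ j ≠ 0 := fun j => by simp
  have hsorted : (γ.support.sort (· ≤ ·)).Pairwise (· < ·) := (γ.support.sortedLT_sort).pairwise
  have hkl := (hmem k).2 hk
  rw [nlft] at hb'
  rcases hl : γ.support.sort (· ≤ ·) with _ | ⟨m, l⟩
  · rw [hl] at hkl; simp at hkl
  rw [hl] at hb' hsorted hkl
  rw [List.pairwise_cons] at hsorted
  obtain ⟨h1, h2, h3⟩ := orderGE_prod_nlftFactor γ l hsorted.2 (m + 1) fun j hj => hsorted.1 j hj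
  rw [List.map_cons, List.prod_cons, nlftFactor_mul_apply_zero_one] at hb'
  have hm : b.coeff m ≠ 0 := by
    rw [← hb', coeff_C_mul, AddMonoidAlgebra.coeff_add, Finsupp.add_apply, coeff_C_mul,
      coeff_T_mul, h1 m (by omega), zero_add, sub_self]
    refine mul_ne_zero (Complex.ofReal_ne_zero.2 (invRadius_pos _).ne') (mul_ne_zero ?_ h3)
    exact (hmem m).1 (by rw [hl]; exact List.mem_cons_self)
  have hm0 : 0 ≤ m := not_lt.1 fun hlt => hm (hb m hlt)
  rcases List.mem_cons.1 hkl with rfl | hkl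
  · exact hm0
  · exact hm0.trans (hsorted.1 k hkl).le

/-! ### The transform as a product over an initial segment of the natural numbers -/

theorem prod_map_filter_of_eq_one {M : Type*} [Monoid M] (l : List ℤ) (p : ℤ → Bool) (F : ℤ → M)
    (h : ∀ k ∈ l, p k = false → F k = 1) : ((l.filter p).map F).prod = (l.map F).prod := by
  induction l with
  | nil => rfl
  | cons k l ih =>
    have ih' := ih fun j hj => h j (List.mem_cons_of_mem _ hj)
    rw [List.filter_cons, List.map_cons, List.prod_cons]
    split_ifs with hp
    · rw [List.map_cons, List.prod_cons, ih']
    · rw [ih', h k List.mem_cons_self (by simpa using hp), one_mul]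

theorem nlft_eq_prod_range (γ : ℤ →₀ ℂ) (N : ℕ) (h : ∀ k, γ k ≠ 0 → 0 ≤ k ∧ k < N) :
    nlft γ = ((List.range N).map fun k : ℕ => nlftFactor (γ k) k).prod := by
  have hl : γ.support.sort (· ≤ ·) =
      ((List.range N).map fun k : ℕ => (k : ℤ)).filter (fun k => decide (γ k ≠ 0)) := by
    have hs : (((List.range N).map fun k : ℕ => (k : ℤ)).filter
        (fun k => decide (γ k ≠ 0))).Pairwise (· < ·) := by
      refine List.Pairwise.filter _ (List.pairwise_map.2 ?_)
      exact List.pairwise_lt_range.imp fun h => by exact_mod_cast h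
    refine List.Perm.eq_of_pairwise (le := (· < ·)) (fun a b _ _ h1 h2 => absurd h1 h2.not_gt)
      γ.support.sortedLT_sort.pairwise hs ?_
    refine (List.perm_ext_iff_of_nodup (Finset.sort_nodup _ _)
      (hs.imp fun h => h.ne)).2 fun k => ?_
    simp only [Finset.mem_sort, Finsupp.mem_support_iff, List.mem_filter, List.mem_map,
      List.mem_range, decide_eq_true_eq]
    constructor
    · intro hk
      obtain ⟨h1, h2⟩ := h k hk
      exact ⟨⟨k.toNat, by omega, by omega⟩, hk⟩
    · exact fun hk => hk.2
  rw [nlft, hl, prod_map_filter_of_eq_one, List.map_map]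
  · rfl
  · intro k _ hk
    rw [of_not_not (by simpa using hk : ¬ γ k ≠ 0), nlftFactor_zero]

theorem prod_range_nlftFactor (g : ℕ → ℂ) (N : ℕ) :
    ((List.range N).map fun k : ℕ => nlftFactor (g k) k).prod =
      !![conjStar (partialPair g N).1, (partialPair g N).2;
        -conjStar (partialPair g N).2, (partialPair g N).1] := by
  induction N with
  | zero => simp [partialPair, Matrix.one_fin_two]
  | succ N ih =>
    rw [List.range_succ, List.map_append, List.prod_append, ih, List.map_singleton,
      List.prod_singleton, nlftFactor_eq, conjStar_partialPair_fst_succ,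
      conjStar_partialPair_snd_succ, partialPair_fst_succ, partialPair_snd_succ,
      Matrix.mul_fin_two]
    refine Matrix.ext fun i j => ?_
    fin_cases i <;> fin_cases j <;> simp only [Fin.zero_eta, Fin.mk_one, Matrix.of_apply,
      Matrix.cons_val', Matrix.cons_val_zero, Matrix.cons_val_one, Matrix.cons_val_fin_one]
    · ring
    · ring
    · ring
    · ring

theorem IsInverseNLFT.eq_partialPair {γ : ℤ →₀ ℂ} {a b : ℂ[T;T⁻¹]} (h : IsInverseNLFT γ a b)
    {N : ℕ} (hN : ∀ k, γ k ≠ 0 → 0 ≤ k ∧ k < N) :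
    b = (partialPair (fun j => γ j) N).2 ∧ conjStar a = (partialPair (fun j => γ j) N).1 := by
  have h1 : nlft γ = !![a, b; -conjStar b, conjStar a] := h
  rw [nlft_eq_prod_range γ N hN, prod_range_nlftFactor (fun j => γ j)] at h1
  exact ⟨(congrFun (congrFun h1 0) 1).symm, (congrFun (congrFun h1 1) 1).symm⟩

/-- At the largest index `K` of the support, the coefficient of `b` is a nonzero multiple of `γ K`,
so `K < n`. -/
theorem IsInverseNLFT.support {γ : ℤ →₀ ℂ} {a b : ℂ[T;T⁻¹]} (h : IsInverseNLFT γ a b)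
    (hb : OrderGE 0 b) {n : ℕ} (hn : ∀ k : ℤ, (n : ℤ) ≤ k → b.coeff k = 0) :
    ∀ k, γ k ≠ 0 → 0 ≤ k ∧ k < n := by
  have hpos : ∀ k, γ k ≠ 0 → 0 ≤ k := fun k hk => h.nonneg_of_ne_zero hb hk
  intro k hk
  refine ⟨hpos k hk, ?_⟩
  have hne : γ.support.Nonempty := ⟨k, Finsupp.mem_support_iff.2 hk⟩
  have hKmem := γ.support.max'_mem hne
  have hle : ∀ j, γ j ≠ 0 → j ≤ γ.support.max' hne := fun j hj =>
    γ.support.le_max' j (Finsupp.mem_support_iff.2 hj)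
  have hK0 := hpos _ (Finsupp.mem_support_iff.1 hKmem)
  obtain ⟨K, hK⟩ : ∃ K : ℕ, γ.support.max' hne = K := ⟨_, (Int.toNat_of_nonneg hK0).symm⟩
  rw [hK] at hle hKmem
  have hb' := (h.eq_partialPair (N := K + 1) fun j hj =>
    ⟨hpos j hj, by have := hle j hj; push_cast; omega⟩).1
  have hc : b.coeff K ≠ 0 := by
    rw [hb', partialPair_snd_coeff]
    exact mul_ne_zero (Finsupp.mem_support_iff.1 hKmem)
      (Complex.ofReal_ne_zero.2 (partialScale_pos _ _).ne')
  have hKn : (K : ℤ) < n := not_le.1 fun hle => hc (hn K hle)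
  exact (hle k hk).trans_lt hKn

/-! ## Exact layer stripping -/

/-- After all `n` factors the column is `(0, 1)`; undoing the rotations one at a time lowers the
order of the first entry by at most one each. -/
theorem orderGE_stripped (g : ℕ → ℂ) {n k : ℕ} (hk : k ≤ n) :
    OrderGE k (stripped g (partialPair g n).1 (partialPair g n).2 k).1 ∧
      OrderGE 0 (stripped g (partialPair g n).1 (partialPair g n).2 k).2 := by
  induction hk using Nat.decreasingInduction with
  | self =>
    have h1 : (stripped g (partialPair g n).1 (partialPair g n).2 n).1 = 0 := by
      simp only [stripped]; ring
    have h2 : (stripped g (partialPair g n).1 (partialPair g n).2 n).2 = 1 := by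
      simp only [stripped]
      linear_combination partialPair_unitary g n
    rw [h1, h2]
    exact ⟨fun _ _ => rfl, OrderGE.one⟩
  | of_succ k hk ih =>
    obtain ⟨h1, h2⟩ := ih
    have e1 := stripped_fst_succ g (partialPair g n).1 (partialPair g n).2 k
    have e2 := stripped_snd_succ g (partialPair g n).1 (partialPair g n).2 k
    generalize stripped g (partialPair g n).1 (partialPair g n).2 k = u at *
    generalize stripped g (partialPair g n).1 (partialPair g n).2 (k + 1) = v at *
    have hρ := C_invRadius_mul (g k)
    have hT := T_mul_T_neg (k : ℤ)
    have f1 : u.1 = C (invRadius (g k) : ℂ) * (v.1 + C (g k) * (T k * v.2)) := by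
      rw [e1, e2]
      linear_combination (-u.1) * hρ - (C (invRadius (g k) : ℂ) * C (invRadius (g k) : ℂ) *
        C (g k) * C (starRingEnd ℂ (g k)) * u.1) * hT
    have f2 : u.2 =
        C (invRadius (g k) : ℂ) * (v.2 - C (starRingEnd ℂ (g k)) * (T (-k) * v.1)) := by
      rw [e1, e2]
      linear_combination (-u.2) * hρ - (C (invRadius (g k) : ℂ) * C (invRadius (g k) : ℂ) *
        C (g k) * C (starRingEnd ℂ (g k)) * u.2) * hT
    rw [f1, f2]
    push_cast at h1
    exact ⟨((h1.mono (by omega)).add (((h2.T_mul k).mono (by omega)).C_mul _)).C_mul _,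
      (h2.sub (((h1.T_mul (-k)).mono (by omega)).C_mul _)).C_mul _⟩

/-! ## Stability of the layer stripping algorithm -/

section Stability

variable {n : ℕ} {η ε : ℝ} {a b : ℂ[T;T⁻¹]} {γ : ℤ →₀ ℂ}

theorem OuterInstance.orderGE_snd (h : OuterInstance n η a b γ) : OrderGE 0 b := by
  obtain ⟨-, q, hq, -⟩ := h.mem
  rw [← (show Polynomial.toLaurent q = b from hq)]
  exact orderGE_toLaurent q

theorem OuterInstance.support (h : OuterInstance n η a b γ) :
    ∀ k : ℤ, γ k ≠ 0 → 0 ≤ k ∧ k < n :=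
  h.inverse.support h.orderGE_snd h.degree_lt

theorem OuterInstance.eq_partialPair (h : OuterInstance n η a b γ) :
    b = (partialPair (fun j => γ j) n).2 ∧ conjStar a = (partialPair (fun j => γ j) n).1 :=
  h.inverse.eq_partialPair h.support

theorem OuterInstance.snd_ne_zero (h : OuterInstance n η a b γ) : b ≠ 0 := by
  rintro rfl
  obtain ⟨-, q, hq, hpos, -⟩ := h.mem
  have hq0 : q = 0 := by
    have hq' : Polynomial.toLaurent q = 0 := hq
    simpa using hq'
  rw [hq0] at hpos
  simp at hpos

theorem OuterInstance.pos (h : OuterInstance n η a b γ) : 0 < n := by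
  rcases Nat.eq_zero_or_pos n with rfl | hn
  · exact absurd h.eq_partialPair.1 h.snd_ne_zero
  · exact hn

theorem OuterInstance.coeffVec_ne_zero (h : OuterInstance n η a b γ) : coeffVec n γ ≠ 0 := by
  intro h0
  have hγ : ∀ j < n, γ j = 0 := fun j hj => by
    have := congrFun (congrArg WithLp.ofLp h0) ⟨j, hj⟩
    simpa [coeffVec] using this
  have hle := norm_partialPair_snd_le_sum (fun j : ℕ => γ j) n
  rw [← h.eq_partialPair.1, Finset.sum_eq_zero fun j hj => by
    rw [hγ j (Finset.mem_range.1 hj), norm_zero]] at hle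
  refine h.snd_ne_zero (LaurentPolynomial.ext fun k => ?_)
  simpa using (norm_coeff_le b k).trans hle

theorem OuterInstance.exists_approx_inverse (h : OuterInstance n η a b γ) :
    ∃ t : ℂ[T;T⁻¹], OrderGE 0 t ∧ OrderGE n (conjStar a * t - 1) ∧
      ∀ f, √η * ‖toL2 (t * f)‖ ≤ 2 * ‖toL2 f‖ := by
  obtain ⟨⟨hab, -⟩, q, hq, -, hsup⟩ := h.mem
  obtain ⟨p, hp, hroot⟩ := h.outer
  simp only at hab hq
  have hpq : Polynomial.toLaurent p * conjStar (Polynomial.toLaurent p) +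
      Polynomial.toLaurent q * conjStar (Polynomial.toLaurent q) = 1 := by
    rw [hp, hq, conjStar_conjStar, mul_comm (conjStar a)]; exact hab
  have hbdd : BddAbove (Set.range fun z : Circle => ‖q.eval (z : ℂ)‖) :=
    (isCompact_range (by fun_prop)).bddAbove
  obtain ⟨t, ht1, ht2⟩ := NLFT.exists_approx_inverse h.eta_pos h.eta_lt_one hpq
    (fun z => (le_ciSup hbdd z).trans hsup) hroot n
  exact ⟨Polynomial.toLaurent t, orderGE_toLaurent t, by rw [← hp]; exact ht1, ht2⟩

/-- The perturbation bound loses `L²`, and division by the squared scale loses `L²` again. The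
constant is `680 · 16`, where `680 = 3 · 160 + 200`. -/
theorem OuterInstance.norm_sub_le (h : OuterInstance n η a b γ) (hε : 0 ≤ ε) (hε1 : ε ≤ 1 / 100)
    (hn : 80 * (n * ε) ≤ 1) {A B : ℕ → ℕ → ℂ} {g : ℕ → ℂ} {r : ℕ → ℝ}
    (hrun : LayerStrippingRun ε n (fun j => (conjStar a).coeff (j : ℤ)) (fun j => b.coeff (j : ℤ))
      A B g r) {k : ℕ} (hk : k < n) :
    ‖g k - γ k‖ ≤ 10880 * (n * ε / η ^ 2) *
      (∑ j ∈ Finset.range n, ‖γ j‖ + ∑ j ∈ Finset.range n, ‖g j‖) := by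
  obtain ⟨hb, hα⟩ := h.eq_partialPair
  obtain ⟨t, ht, hinv, hbd⟩ := h.exists_approx_inverse
  have hη := h.eta_pos
  have hsη : 0 < √η := Real.sqrt_pos.2 hη
  have hsη1 : √η ≤ 1 := Real.sqrt_le_one.2 h.eta_lt_one.le
  have hαo : OrderGE 0 (conjStar a) := by rw [hα]; exact (orderGE_partialPair _ n).1
  have hα0 : (conjStar a).coeff 0 = (partialScale (fun j => γ j) n : ℂ) := by
    rw [hα]; exact partialPair_fst_coeff_zero _ n
  have hscale := partialScale_pos (fun j : ℕ => γ j) n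
  have hunit : pairNorm (b, conjStar a) ≤ 1 := by
    refine le_of_sq_le_sq ?_ zero_le_one
    rw [pairNorm_sq, hb, hα, add_comm]
    simpa using (norm_partialPair_sq (fun j : ℕ => γ j) n).le
  obtain ⟨R₁, R₂, r1, r2, r3, r4, r5⟩ := hrun.exists_residual hε hε1 hαo h.orderGE_snd
    (by rw [hα0]; exact Complex.ofReal_ne_zero.2 hscale.ne') hunit hn (k := k + 1) hk
  obtain ⟨s1, s2⟩ := orderGE_stripped (fun j : ℕ => γ j) (k := k + 1) (n := n) hk
  rw [← hb, ← hα] at s1 s2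
  have hmain := norm_sub_le_of_stripped (fun j : ℕ => γ j) g ht
    (hinv.mono (by exact_mod_cast hk : (k : ℤ) + 1 ≤ n)) (by exact_mod_cast s1) s2
    (by exact_mod_cast r1) r2
  -- the bounds `‖t f‖ ≤ L ‖f‖` and `L⁻¹ ≤ partialScale`
  set L : ℝ := 2 / √η with hL
  have hL1 : 1 ≤ L := by rw [hL, le_div_iff₀ hsη]; linarith
  have hLsq : L ^ 2 = 4 / η := by rw [hL, div_pow, Real.sq_sqrt hη.le]; norm_num
  have hbd' : ∀ f, ‖toL2 (t * f)‖ ≤ L * ‖toL2 f‖ := fun f => by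
    rw [hL, div_mul_eq_mul_div, le_div_iff₀ hsη, mul_comm]; exact hbd f
  -- Constant coefficients in `α t = 1 + O(z^n)`: the scale times `t.coeff 0` is `1`, and `‖t.coeff
  -- 0‖ ≤ L`.
  have ht0 : 1 ≤ partialScale (fun j => γ j) n * L := by
    have h1 := hinv 0 (by exact_mod_cast h.pos)
    have h2 := hαo.coeff_mul ht
    rw [AddMonoidAlgebra.coeff_sub, Finsupp.sub_apply] at h1
    rw [add_zero, hα0] at h2
    rw [h2] at h1
    have h3 : (partialScale (fun j => γ j) n : ℂ) * t.coeff 0 = 1 := by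
      simpa [sub_eq_zero] using h1
    have h4 := congrArg norm h3
    rw [norm_mul, Complex.norm_real, Real.norm_of_nonneg hscale.le, norm_one] at h4
    have h5 := (norm_coeff_le t 0).trans (by simpa [norm_toL2_one] using hbd' 1)
    rw [← h4]
    gcongr
  have hc : 1 ≤ partialScale (fun j => γ j) (k + 1) * L :=
    ht0.trans (by gcongr; exact partialScale_antitone _ hk)
  have hbS : ‖toL2 b‖ ≤ ∑ j ∈ Finset.range n, ‖γ j‖ := by
    rw [hb]; exact norm_partialPair_snd_le_sum _ n
  have hgS : ‖g k‖ ≤ ∑ j ∈ Finset.range n, ‖g j‖ :=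
    Finset.single_le_sum (f := fun j => ‖g j‖) (fun _ _ => norm_nonneg _) (Finset.mem_range.2 hk)
  set S := ∑ j ∈ Finset.range n, ‖γ j‖
  set Ŝ := ∑ j ∈ Finset.range n, ‖g j‖
  have hS0 : 0 ≤ S := (norm_nonneg _).trans hbS
  have hT0 : 0 ≤ Ŝ := (norm_nonneg _).trans hgS
  have hL0 : 0 < L := by linarith
  have hnε : 0 ≤ n * ε := by positivity
  have b1 : ‖toL2 (t * R₁)‖ ≤ L * (80 * (n * ε)) := (hbd' _).trans (by gcongr)
  have b2 : ‖toL2 (t * R₂)‖ ≤ L * (80 * (n * ε)) := (hbd' _).trans (by gcongr)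
  have b3 : ‖toL2 (t * R₁)‖ ≤ L * L * (200 * (n * ε) * (S + Ŝ)) := by
    calc ‖toL2 (t * R₁)‖ ≤ L * (200 * (n * ε) * (S + Ŝ)) :=
          (hbd' _).trans (by gcongr; exact r3.trans (by gcongr))
      _ ≤ L * L * (200 * (n * ε) * (S + Ŝ)) := by
          gcongr; exact le_mul_of_one_le_left hL0.le hL1
  have b4 : ‖toL2 (t * b)‖ + ‖g k‖ ≤ L * (S + Ŝ) := by
    rw [mul_add]
    exact add_le_add ((hbd' _).trans (by gcongr)) (hgS.trans (le_mul_of_one_le_left hT0 hL1))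
  have b5 : partialScale (fun j => γ j) (k + 1) ^ 2 * ‖g k - γ k‖ ≤
      680 * (L ^ 2 * (n * ε)) * (S + Ŝ) := by
    refine hmain.trans ?_
    calc _ ≤ 3 * (L * (80 * (n * ε)) + L * (80 * (n * ε))) * (L * (S + Ŝ)) +
          L * L * (200 * (n * ε) * (S + Ŝ)) := by gcongr
      _ = _ := by ring
  have hc2 : 1 ≤ (partialScale (fun j => γ j) (k + 1) * L) ^ 2 := one_le_pow₀ hc
  calc ‖g k - γ k‖ ≤ (partialScale (fun j => γ j) (k + 1) * L) ^ 2 * ‖g k - γ k‖ :=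
        le_mul_of_one_le_left (norm_nonneg _) hc2
    _ = L ^ 2 * (partialScale (fun j => γ j) (k + 1) ^ 2 * ‖g k - γ k‖) := by ring
    _ ≤ L ^ 2 * (680 * (L ^ 2 * (n * ε)) * (S + Ŝ)) := by gcongr
    _ = _ := by rw [hLsq]; field_simp; ring

theorem norm_le_sum_norm (v : EuclideanSpace ℂ (Fin n)) : ‖v‖ ≤ ∑ i, ‖v i‖ := by
  refine le_of_sq_le_sq ?_ (Finset.sum_nonneg fun _ _ => norm_nonneg _)
  rw [EuclideanSpace.norm_sq_eq]
  exact Finset.sum_sq_le_sq_sum_of_nonneg fun _ _ => norm_nonneg _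

/-- One factor `n` is the accumulated residual, one comes from summing over `k`, and one from
bounding the `ℓ¹` norm of `γ` by its `ℓ²` norm. -/
theorem OuterInstance.norm_output_sub_le (h : OuterInstance n η a b γ) (hε : 0 < ε)
    (hc : (n : ℝ) ^ 3 * η ^ (-(5 / 2) : ℝ) * ε ≤ 1 / 40000) {g : EuclideanSpace ℂ (Fin n)}
    (hg : LayerStrippingOutput ε n a b g) :
    ‖g - coeffVec n γ‖ ≤
      32640 * ((n : ℝ) ^ 3 * η ^ (-(5 / 2) : ℝ) * ε) * ‖coeffVec n γ‖ := by
  obtain ⟨A, B, g', r, hrun, hgg⟩ := hg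
  have hη := h.eta_pos
  have hn1 : (1 : ℝ) ≤ n := by exact_mod_cast h.pos
  have hη2 : 1 / η ^ 2 ≤ η ^ (-(5 / 2) : ℝ) := by
    have e : 1 / η ^ 2 = η ^ (-2 : ℝ) := by
      rw [Real.rpow_neg hη.le, one_div]; norm_num
    rw [e]
    exact Real.rpow_le_rpow_of_exponent_ge hη h.eta_lt_one.le (by norm_num)
  have hη1 : 1 ≤ 1 / η ^ 2 := by
    rw [le_div_iff₀ (by positivity)]
    nlinarith [h.eta_lt_one]
  set X := (n : ℝ) ^ 3 * η ^ (-(5 / 2) : ℝ) * ε with hX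
  have hX3 : (n : ℝ) ^ 3 * (1 / η ^ 2) * ε ≤ X := by rw [hX]; gcongr
  have hX1 : n * ε ≤ X := by
    refine le_trans ?_ hX3
    calc n * ε ≤ n * ε * ((n : ℝ) ^ 2 * (1 / η ^ 2)) :=
          le_mul_of_one_le_right (by positivity)
            (one_le_mul_of_one_le_of_one_le (one_le_pow₀ hn1) hη1)
      _ = _ := by ring
  have hX2 : (n : ℝ) * (10880 * (n * ε / η ^ 2)) ≤ 10880 * X := by
    refine le_trans ?_ (mul_le_mul_of_nonneg_left hX3 (by norm_num))
    calc (n : ℝ) * (10880 * (n * ε / η ^ 2)) ≤ n * (10880 * (n * ε / η ^ 2)) * n :=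
          le_mul_of_one_le_right (by positivity) hn1
      _ = _ := by ring
  have hεX : ε ≤ n * ε := le_mul_of_one_le_left hε.le hn1
  have key := fun k (hk : k < n) =>
    h.norm_sub_le hε.le (by linarith) (by linarith) hrun hk
  set S := ∑ j ∈ Finset.range n, ‖γ j‖ with hS
  set Ŝ := ∑ j ∈ Finset.range n, ‖g' j‖ with hŜ
  set κ := 10880 * (n * ε / η ^ 2) with hκ
  have hS0 : 0 ≤ S := by positivity
  have hT0 : 0 ≤ Ŝ := by positivity
  have hκ0 : 0 ≤ κ := by positivity
  -- Summing the pointwise bound gives `Ŝ ≤ S + n κ (S + Ŝ)`; the smallness assumption makes `n κ ≤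
  -- 10880 / 40000 ≤ 1 / 3`, so `Ŝ` is absorbed.
  have hT : Ŝ ≤ 2 * S := by
    have h1 : Ŝ ≤ S + n * (κ * (S + Ŝ)) := by
      have h2 : Ŝ ≤ ∑ j ∈ Finset.range n, (‖γ j‖ + κ * (S + Ŝ)) := by
        refine Finset.sum_le_sum fun j hj => ?_
        have h3 := key j (Finset.mem_range.1 hj)
        have h4 := norm_sub_norm_le (g' j) (γ j)
        linarith
      rw [Finset.sum_add_distrib, Finset.sum_const, Finset.card_range, nsmul_eq_mul] at h2
      exact h2
    have h5 : n * κ * (S + Ŝ) ≤ 1 / 3 * (S + Ŝ) := by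
      gcongr
      linarith
    linarith
  have hSn : S ≤ n * ‖coeffVec n γ‖ := by
    rw [hS, Finset.sum_range]
    refine (Finset.sum_le_card_nsmul _ _ _ fun i _ =>
      PiLp.norm_apply_le (coeffVec n γ) i).trans ?_
    simp
  calc ‖g - coeffVec n γ‖ ≤ ∑ i, ‖(g - coeffVec n γ) i‖ := norm_le_sum_norm _
    _ ≤ ∑ _i : Fin n, κ * (3 * S) := by
        refine Finset.sum_le_sum fun i _ => ?_
        have e : (g - coeffVec n γ) i = g' i - γ (i : ℕ) := by
          rw [PiLp.sub_apply, hgg i]; rfl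
        rw [e]
        refine (key i i.2).trans ?_
        gcongr
        linarith
    _ = n * κ * (3 * S) := by simp; ring
    _ ≤ n * κ * (3 * (n * ‖coeffVec n γ‖)) := by gcongr
    _ = 32640 * ((n : ℝ) ^ 3 * (1 / η ^ 2) * ε) * ‖coeffVec n γ‖ := by rw [hκ]; ring
    _ ≤ 32640 * X * ‖coeffVec n γ‖ := by gcongr

/-- For `n = 1` the only operation is one division of exact data, so the error is a single rounding.
-/
theorem OuterInstance.relError_le_of_length_one (h : OuterInstance 1 η a b γ)
    {g : EuclideanSpace ℂ (Fin 1)} (hε : 0 ≤ ε) (hg : LayerStrippingOutput ε 1 a b g) :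
    relError g (coeffVec 1 γ) ≤ ε := by
  obtain ⟨A, B, g', r, hrun, hgg⟩ := hg
  obtain ⟨δ, hδ, hgδ⟩ := hrun.coefficient 0 one_pos
  obtain ⟨hb, hα⟩ := h.eq_partialPair
  have hb0 : b.coeff 0 = γ 0 * (partialScale (fun j => γ j) 1 : ℂ) := by
    rw [hb]; exact partialPair_snd_coeff (fun j : ℕ => γ j) 0
  have hα0 : (conjStar a).coeff 0 = (partialScale (fun j => γ j) 1 : ℂ) := by
    rw [hα]; exact partialPair_fst_coeff_zero _ 1
  have hs : (partialScale (fun j => γ j) 1 : ℂ) ≠ 0 :=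
    Complex.ofReal_ne_zero.2 (partialScale_pos _ _).ne'
  rw [hrun.init_a 0 one_pos, hrun.init_b 0 one_pos] at hgδ
  simp only [Nat.cast_zero] at hgδ
  rw [hb0, hα0, mul_div_cancel_right₀ _ hs] at hgδ
  have e : g - coeffVec 1 γ = δ • coeffVec 1 γ := by
    ext i
    obtain rfl : i = 0 := Subsingleton.elim _ _
    rw [PiLp.sub_apply, hgg 0, PiLp.smul_apply, smul_eq_mul]
    have e' : coeffVec 1 γ 0 = γ 0 := rfl
    rw [e', Fin.val_zero, hgδ]
    ring
  rw [relError, e, norm_smul]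
  exact div_le_of_le_mul₀ (norm_nonneg _) hε (by gcongr)

/-! ### From machine precision to bits -/

theorem inv_two_pow_le_of_log_le {X : ℝ} (hX : 0 < X) {K r : ℕ}
    (h : K / Real.log 2 * Real.log X ≤ r) : (2 : ℝ)⁻¹ ^ r ≤ (X ^ K)⁻¹ := by
  rw [inv_pow]
  refine inv_anti₀ (by positivity) ?_
  rw [← Real.log_le_log_iff (by positivity) (by positivity), Real.log_pow, Real.log_pow]
  have h2 := Real.log_pos one_lt_two
  rwa [div_mul_eq_mul_div, div_le_iff₀ h2] at h

/-- The exponent is `20 = 3 + 16 + 1`: three powers of `X` pay for `n³ η^(-5/2)`, sixteen for the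
absolute constants, one for `τ`. -/
theorem OuterInstance.bitsSuffice (h : OuterInstance n η a b γ) {τ : ℝ} (hτ : 0 < τ) (hτ1 : τ < 1)
    {r : ℕ} (hr : (20 : ℕ) / Real.log 2 * Real.log (n * η⁻¹ * τ⁻¹) ≤ r) :
    BitsSuffice r n a b (coeffVec n γ) τ := by
  intro g hg
  have hη := h.eta_pos
  have hn1 : (1 : ℝ) ≤ n := by exact_mod_cast h.pos
  have hηi : 1 ≤ η⁻¹ := (one_le_inv₀ hη).2 h.eta_lt_one.le
  have hτi : 1 ≤ τ⁻¹ := (one_le_inv₀ hτ).2 hτ1.le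
  set X := n * η⁻¹ * τ⁻¹ with hX
  have hX0 : 0 < X := by positivity
  have hXτ : τ⁻¹ ≤ X :=
    le_mul_of_one_le_left (by positivity) (one_le_mul_of_one_le_of_one_le hn1 hηi)
  have hX1 : 1 ≤ X := hτi.trans hXτ
  have hXinv : X⁻¹ ≤ τ := inv_le_of_inv_le₀ hτ hXτ
  have hpow := inv_two_pow_le_of_log_le hX0 hr
  have hε : 0 < (2 : ℝ)⁻¹ ^ r := by positivity
  -- For `n ≥ 2` one has `X ≥ 2`, so powers of `X` beat absolute constants. For `n = 1` the number
  -- `X` can be close to `1`, and the sharper bound without a constant is needed.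
  rcases Nat.lt_or_ge 1 n with hn | hn
  · have hn2 : (2 : ℝ) ≤ n := by exact_mod_cast hn
    have hXn : (n : ℝ) * η⁻¹ ≤ X := le_mul_of_one_le_right (by positivity) hτi
    have hX2 : 2 ≤ X := hn2.trans ((le_mul_of_one_le_right (by positivity) hηi).trans hXn)
    have hηp : η ^ (-(5 / 2) : ℝ) ≤ η⁻¹ ^ 3 := by
      have e : η⁻¹ ^ 3 = η ^ (-3 : ℝ) := by
        rw [Real.rpow_neg hη.le, inv_pow]; norm_num
      rw [e]
      exact Real.rpow_le_rpow_of_exponent_ge hη h.eta_lt_one.le (by norm_num)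
    have hY : (n : ℝ) ^ 3 * η ^ (-(5 / 2) : ℝ) * (2 : ℝ)⁻¹ ^ r ≤ 1 / 65536 * τ := by
      calc (n : ℝ) ^ 3 * η ^ (-(5 / 2) : ℝ) * (2 : ℝ)⁻¹ ^ r
          ≤ (n : ℝ) ^ 3 * η⁻¹ ^ 3 * (X ^ 20)⁻¹ := by gcongr
        _ = ((n : ℝ) * η⁻¹) ^ 3 * (X ^ 20)⁻¹ := by ring
        _ ≤ X ^ 3 * (X ^ 20)⁻¹ := by gcongr
        _ = (X ^ 16)⁻¹ * X⁻¹ := by field_simp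
        _ ≤ (2 ^ 16)⁻¹ * τ := by gcongr
        _ = 1 / 65536 * τ := by norm_num
    have hmain := h.norm_output_sub_le hε (by linarith) hg
    rw [relError]
    refine div_le_of_le_mul₀ (norm_nonneg _) hτ.le (hmain.trans ?_)
    gcongr
    linarith
  · obtain rfl : n = 1 := le_antisymm hn h.pos
    refine (h.relError_le_of_length_one hε.le hg).trans (hpow.trans ?_)
    refine le_trans (inv_anti₀ hX0 ?_) hXinv
    exact le_self_pow₀ hX1 (by norm_num)

end Stability

end NLFT

theorem mainTheorem1 :
    (∃ c C : ℝ, 0 < c ∧ 0 < C ∧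
      ∀ (n : ℕ) (η ε : ℝ) (a b : LaurentPolynomial ℂ) (γ : ℤ →₀ ℂ),
        NLFT.OuterInstance n η a b γ → 0 < ε →
        (n : ℝ) ^ 3 * η ^ (-(5 / 2) : ℝ) * ε ≤ c →
        (∀ k : ℤ, γ k ≠ 0 → 0 ≤ k ∧ k < n) ∧ NLFT.coeffVec n γ ≠ 0 ∧
        ∀ g : EuclideanSpace ℂ (Fin n), NLFT.LayerStrippingOutput ε n a b g →
          NLFT.relError g (NLFT.coeffVec n γ) ≤ C * ((n : ℝ) ^ 3 * η ^ (-(5 / 2) : ℝ) * ε)) ∧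
    (∃ C : ℝ, 0 < C ∧
      ∀ (n : ℕ) (η τ : ℝ) (a b : LaurentPolynomial ℂ) (γ : ℤ →₀ ℂ),
        NLFT.OuterInstance n η a b γ → 0 < τ → τ < 1 →
        ∀ r : ℕ, C * Real.log (n * η⁻¹ * τ⁻¹) ≤ r →
          NLFT.BitsSuffice r n a b (NLFT.coeffVec n γ) τ) := by
  refine ⟨⟨1 / 40000, 32640, by norm_num, by norm_num, ?_⟩,
    (20 : ℕ) / Real.log 2, div_pos (by norm_num) (Real.log_pos one_lt_two), ?_⟩
  · intro n η ε a b γ h hε hc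
    refine ⟨h.support, h.coeffVec_ne_zero, fun g hg => ?_⟩
    have hη := h.eta_pos
    exact div_le_of_le_mul₀ (norm_nonneg _) (by positivity) (h.norm_output_sub_le hε hc hg)
  · intro n η τ a b γ h hτ hτ1 r hr
    exact h.bitsSuffice hτ hτ1 hr
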